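/- Theorem 1.3. For every $\delta\in(0,1)$ there is a constant $C_\delta>0$, depending only on $\delta$, such that the following holds. Let $q$ be a prime power and let $n,k$ be integers with $n\ge 2$, $1\le k\le n$, $n\ge 4(1-\delta)/\delta^2$ and $q\ge 1/(1-\delta)^2$. Put $r=(k-1)/\log n$ and suppose that $r\le q(1-\delta)$. Then the infinite product $$h_q(r)=\prod_{P}\Big(1-\frac{r}{|P|}\Big)^{-1}\Big(1-\frac1{|P|}\Big)^{r},$$ over all monic irreducible polynomials $P\in\mathbb F_q[T]$, with $|P|=q^{\deg P}$, converges (unconditionally), and $$\Big|\mathbb P(\Omega(f_n)=k)-\mathbb P(K(\pi_n)=k)\,h_q(r)\Big|\le C_\delta\,(r+1)^{C_\delta r}\,\mathbb P(X=k-1)\,\frac{k}{q(\log n)^2}.$$ Here $f_n$ is a uniformly random monic polynomial of degree $n$ over $\mathbb F_q$, $\Omega(f)$ is the number of monic irreducible factors of $f$ counted with multiplicity, $\pi_n$ is a uniformly random permutation in the symmetric group $S_n$, $K(\pi)$ is the number of cycles of $\pi$ (fixed points included), and $X$ is a Poisson random variable with mean $\log n$. -/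

import Mathlib

open Polynomial

noncomputable section

/-- The probability of the event `p` for an element drawn uniformly at random from the finite
nonempty set `S`. -/
def uniformProb {α : Type*} (S : Set α) (p : α → Prop) : ℝ :=
  ({x | x ∈ S ∧ p x}.ncard : ℝ) / (S.ncard : ℝ)

/-- The monic polynomials of degree `n` over `F`. -/
def monicsOfDegree (F : Type*) [Field F] (n : ℕ) : Set F[X] :=
  {f | f.Monic ∧ f.natDegree = n}

open Classical in
/-- `Ω(f)`: the number of monic prime factors of `f` (for `f ≠ 0`), counted with multiplicity. -/
def bigOmega {F : Type*} [Field F] (f : F[X]) : ℕ :=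
  Multiset.card (UniqueFactorizationMonoid.normalizedFactors f)

/-- `K(σ)`: the number of cycles of a permutation of `{0, …, n - 1}`, fixed points included. -/
def numCycles {n : ℕ} (σ : Equiv.Perm (Fin n)) : ℕ :=
  Multiset.card σ.partition.parts

/-- `P(Ω(f_n) = k)` for a uniformly random monic polynomial `f_n` of degree `n` over `F`. -/
def probOmega (F : Type*) [Field F] (n k : ℕ) : ℝ :=
  uniformProb (monicsOfDegree F n) (fun f => bigOmega f = k)

/-- `P(K(π_n) = k)` for a uniformly random permutation `π_n` in the symmetric group `S_n`. -/
def probCycles (n k : ℕ) : ℝ :=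
  uniformProb (Set.univ : Set (Equiv.Perm (Fin n))) (fun σ => numCycles σ = k)

/-- `P(X = j)` for a Poisson random variable `X` with mean `log n` (note `log n ≥ 0`). -/
def probPoissonLog (n j : ℕ) : ℝ :=
  (ProbabilityTheory.poissonMeasure (Real.log n).toNNReal).real {j}

/-- The set of monic irreducible polynomials over `F`. -/
def monicPrimes (F : Type*) [Field F] : Set F[X] :=
  {P | P.Monic ∧ Irreducible P}

/-- `|P| = q ^ deg P`, where `q` is the cardinality of the finite field `F`. -/
def polyNorm {F : Type*} [Field F] (P : F[X]) : ℝ :=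
  (Nat.card F : ℝ) ^ P.natDegree

/-- The Euler factor `(1 - x / |P|)⁻¹ (1 - 1 / |P|) ^ x` of `h_q` at `P`. -/
def hFactor {F : Type*} [Field F] (x : ℝ) (P : F[X]) : ℝ :=
  (1 - x / polyNorm P)⁻¹ * (1 - 1 / polyNorm P) ^ x

/-- `h_q(x)`: the product of the Euler factors over all monic irreducible polynomials. -/
def hEuler (F : Type*) [Field F] (x : ℝ) : ℝ :=
  ∏' P : monicPrimes F, hFactor x (P : F[X])

end

/-!
Write `q` for the cardinality of `F`, `L = log n`, `K = k - 1` and `r = K / L`. The generating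
functions `∑ u ^ n E z ^ Ω(f_n)` and `∑ u ^ n E z ^ K(π_n) = (1 - u) ^ (-z) = ∑ A_n(z) u ^ n` are
compared through their logarithmic derivatives in `u`. For polynomials, this derivative has
coefficients `q ^ (-j) ∑ deg P · z ^ i`, over the prime powers `P ^ i` of degree `j`
(`natCast_mul_omegaSum`); at `z = 1` the sum is `1`, so it differs from `z` by
`e_j(z) = q ^ (-j) ∑ deg P · (z ^ i - z)`, to which only the proper prime powers contribute. Hence
`E z ^ Ω(f_n) = ∑_m g_m(z) A_{n - m}(z)`, with `∑ g_m u ^ m = exp (∑ e_j u ^ j / j)`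
(`C_inv_mul_omegaSum`). Evaluated at `u = 1`, the right side is the Euler product `h_q(z)`
(`tsum_expCoeff_eq_exp`, `hasProd_hFactor`).

The argument uses no contour integrals: everything is estimated by the weighted norms
`∑ |a_j| R ^ j` of power series in `z`, which are submultiplicative. Since the primes themselves do
not contribute to `e_j`, the norms of the `g_m`, `m ≥ 1`, on a disc slightly larger than `|z| ≤ r`
decay exponentially and sum to `O(1 / q)` (`sum_errBound_mul_pow_le`,
`sum_natCast_mul_expCoeff_le`). It remains to treat
`[z ^ k] ∑_{m ≥ 1} (g_m(z) A_{n - m}(z) - g_m(r) A_n(z))`, term by term.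

* Replacing `A_{n - m}` by `A_n` costs a factor `m ^ 3 / n`, because
  `A_{j + 1} - A_j = (z - 1) A_j / (j + 1)`. With so much room the trivial bound for a coefficient
  by the norm at radius `r`, which loses a factor of order `√k`, is enough
  (`abs_coeff_mul_cyclePolySub_sub_le`).
* For `g_m(z) - g_m(r) = (z - r) Q(z)`, write `n A_n(z) / z = e ^ (L z) W(z)` with `W` of bounded
  norm. As `K = r L`, the coefficient of `z ^ K` in `e ^ (L z) (z - r) z ^ j` is exactly
  `-j L ^ (K - j - 1) / (K - j)!`, at most `L ^ K / K! · (K / L ^ 2) · j r ^ (j - 1)` in absolute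
  value. This is where the second order saving `k / (log n) ^ 2` comes from
  (`abs_coeff_expSeries_mul_sub_le`, `abs_coeff_sub_eval_mul_cyclePoly_le`).
-/

noncomputable section

open Finset.HasAntidiagonal (antidiagonal mem_antidiagonal)
open scoped PowerSeries

/-! ### The number of cycles of a random permutation -/

open Equiv Equiv.Perm in
/-- Multiplying by the transposition `(x, g x)` splits `x` off its cycle. -/
lemma card_parts_swap_mul {α : Type*} [Fintype α] [DecidableEq α] (g : Perm α) {x : α}
    (hx : g x ≠ x) :
    Multiset.card (swap x (g x) * g).partition.parts =
      Multiset.card g.partition.parts + 1 := by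
  obtain ⟨c, hc⟩ : ∃ c, c = g.cycleOf x := ⟨_, rfl⟩
  have hcx : c x = g x := by rw [hc, cycleOf_apply_self]
  have hcyc : c.IsCycle := hc ▸ isCycle_cycleOf g hx
  obtain ⟨d, hd⟩ : ∃ d, d = c⁻¹ * g := ⟨_, rfl⟩
  have hg : g = c * d := by rw [hd]; group
  have hdis : Perm.Disjoint c d := by
    have h := (disjoint_mul_inv_of_mem_cycleFactorsFinset
      (f := c) (g := g) (by rw [hc, cycleOf_mem_cycleFactorsFinset_iff]; simpa using hx)).symm
    have hcomm : g * c⁻¹ = c⁻¹ * g := by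
      have h2 : Commute c (g * c⁻¹) := h.commute
      have h3 : c * (g * c⁻¹) = g := by rw [h2.eq]; group
      nth_rewrite 2 [← h3]
      group
    rw [hd, ← hcomm]
    exact h
  have hcx' : c x ≠ x := by rwa [hcx]
  have hcard : c.support.card + d.support.card ≤ Fintype.card α := by
    rw [← hdis.card_support_mul]; exact Finset.card_le_univ _
  rw [← hcx, hg, ← mul_assoc]
  by_cases h : c (c x) = x
  · have hs : c = swap x (c x) := hcyc.eq_swap_of_apply_apply_eq_self hcx' h
    have h1 : swap x (c x) * c = 1 := by
      nth_rewrite 2 [hs]; exact swap_mul_self _ _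
    have h2 : c.support.card = 2 := by rw [hs]; exact card_support_swap (Ne.symm hcx')
    rw [h1, one_mul, parts_partition, parts_partition, hdis.cycleType_mul,
      hdis.card_support_mul, hcyc.cycleType]
    simp only [Multiset.card_add, Multiset.card_replicate, Multiset.card_singleton]
    omega
  · have hcyc' := hcyc.swap_mul hcx' h
    have hsup := support_swap_mul_eq c x h
    have hdis' : Perm.Disjoint (swap x (c x) * c) d := by
      rw [disjoint_iff_disjoint_support] at hdis ⊢
      rw [hsup]
      exact hdis.mono_left Finset.sdiff_subset
    have h2 : (swap x (c x) * c).support.card + 1 = c.support.card := by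
      rw [hsup, Finset.sdiff_singleton_eq_erase]
      exact Finset.card_erase_add_one (mem_support.2 hcx')
    rw [parts_partition, parts_partition, hdis.cycleType_mul, hdis'.cycleType_mul,
      hdis.card_support_mul, hdis'.card_support_mul, hcyc.cycleType, hcyc'.cycleType]
    simp only [Multiset.card_add, Multiset.card_replicate, Multiset.card_singleton]
    omega

open Equiv Equiv.Perm in
lemma numCycles_decomposeFin_zero {n : ℕ} (e : Perm (Fin n)) :
    numCycles (decomposeFin.symm (0, e)) = numCycles e + 1 := by
  have h : decomposeFin.symm (0, e) = e.extendDomain (finSuccAboveEquiv (0 : Fin (n + 1))) := by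
    ext x
    refine Fin.cases ?_ (fun y => ?_) x
    · rw [decomposeFin_symm_apply_zero, extendDomain_apply_not_subtype]
      simp
    · rw [decomposeFin_symm_apply_succ, swap_self]
      have : y.succ = (finSuccAboveEquiv (0 : Fin (n + 1)) y : Fin (n + 1)) := rfl
      rw [this, extendDomain_apply_image]
      rfl
  have hle : e.support.card ≤ n := by simpa using Finset.card_le_univ e.support
  rw [numCycles, numCycles, h, parts_partition, parts_partition, cycleType_extendDomain,
    card_support_extend_domain]
  simp only [Multiset.card_add, Multiset.card_replicate, Fintype.card_fin]
  omega

open Equiv Equiv.Perm in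
lemma numCycles_decomposeFin_succ {n : ℕ} (p : Fin n) (e : Perm (Fin n)) :
    numCycles (decomposeFin.symm (p.succ, e)) = numCycles e := by
  have h0 : decomposeFin.symm (p.succ, e) 0 = p.succ := decomposeFin_symm_apply_zero _ _
  have h := card_parts_swap_mul (decomposeFin.symm (p.succ, e)) (x := 0)
    (by rw [h0]; exact Fin.succ_ne_zero p)
  have h1 : swap 0 (decomposeFin.symm (p.succ, e) 0) * decomposeFin.symm (p.succ, e) =
      decomposeFin.symm (0, e) := by
    ext x
    refine Fin.cases ?_ (fun y => ?_) x
    · simp [h0]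
    · simp [h0, decomposeFin_symm_apply_succ]
  rw [h1] at h
  have h2 := numCycles_decomposeFin_zero e
  rw [numCycles] at h2 ⊢
  omega

/-- The generating polynomial of the number of cycles on `S_n`. -/
lemma sum_X_pow_numCycles (n : ℕ) :
    ∑ σ : Equiv.Perm (Fin n), (X : ℝ[X]) ^ numCycles σ = ascPochhammer ℝ n := by
  induction n with
  | zero =>
    have : numCycles (1 : Equiv.Perm (Fin 0)) = 0 := by
      rw [numCycles, Equiv.Perm.parts_partition]; simp
    simp [this]
  | succ n ih =>
    rw [← Equiv.sum_comp (Equiv.Perm.decomposeFin (n := n)).symm, Fintype.sum_prod_type,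
      Fin.sum_univ_succ, ascPochhammer_succ_right, ← ih]
    simp only [numCycles_decomposeFin_zero, numCycles_decomposeFin_succ, pow_succ,
      Finset.sum_const, Finset.card_univ, Fintype.card_fin, nsmul_eq_mul, ← Finset.sum_mul]
    ring

/-- The probability generating polynomial of the number of cycles of a random permutation. -/
def cyclePoly (n : ℕ) : ℝ[X] := C ((n.factorial : ℝ)⁻¹) * ascPochhammer ℝ n

lemma coeff_cyclePoly (n k : ℕ) : (cyclePoly n).coeff k = probCycles n k := by
  rw [cyclePoly, coeff_C_mul, ← sum_X_pow_numCycles, finsetSum_coeff, probCycles, uniformProb]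
  simp only [coeff_X_pow, Set.mem_univ, true_and, Set.ncard_univ]
  rw [Finset.sum_boole, Nat.card_eq_fintype_card, Fintype.card_perm, Fintype.card_fin,
    Set.ncard_eq_toFinset_card', div_eq_inv_mul]
  congr 3
  ext σ
  simp [eq_comm]

lemma cyclePoly_zero : cyclePoly 0 = 1 := by simp [cyclePoly]

lemma cyclePoly_succ (n : ℕ) :
    cyclePoly (n + 1) = C (((n : ℝ) + 1)⁻¹) * (X + C (n : ℝ)) * cyclePoly n := by
  have h : (((n + 1).factorial : ℕ) : ℝ)⁻¹ = ((n : ℝ) + 1)⁻¹ * (n.factorial : ℝ)⁻¹ := by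
    rw [Nat.factorial_succ]; push_cast; rw [mul_inv]
  rw [cyclePoly, cyclePoly, h, ascPochhammer_succ_right, C_mul]
  simp only [map_natCast]
  ring

/-! ### Prime factors of polynomials over a finite field -/

lemma finite_monicsOfDegree (F : Type*) [Field F] [Finite F] (n : ℕ) :
    (monicsOfDegree F n).Finite := by
  have : Finite (degreeLT F n) := Finite.of_equiv _ (degreeLTEquiv F n).toEquiv.symm
  exact Set.finite_coe_iff.mp (Finite.of_equiv _ (monicEquivDegreeLT n).symm)

/-- The monic polynomials of degree `n` as a `Finset`. -/
def monicFinset (F : Type*) [Field F] [Finite F] (n : ℕ) : Finset F[X] :=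
  (finite_monicsOfDegree F n).toFinset

lemma bigOmega_mul {F : Type*} [Field F] {f g : F[X]} (hf : f ≠ 0) (hg : g ≠ 0) :
    bigOmega (f * g) = bigOmega f + bigOmega g := by
  classical
  simp [bigOmega, UniqueFactorizationMonoid.normalizedFactors_mul hf hg]

lemma bigOmega_pow_of_irreducible {F : Type*} [Field F] {P : F[X]} (hP : Irreducible P) (i : ℕ) :
    bigOmega (P ^ i) = i := by
  classical
  simp [bigOmega, UniqueFactorizationMonoid.normalizedFactors_pow,
    UniqueFactorizationMonoid.normalizedFactors_irreducible hP]

section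
variable {F : Type*} [Field F] [Finite F]

lemma mem_monicFinset {n : ℕ} {f : F[X]} : f ∈ monicFinset F n ↔ f.Monic ∧ f.natDegree = n := by
  simp [monicFinset, monicsOfDegree]

variable (F) in
lemma card_monicFinset (n : ℕ) : (monicFinset F n).card = Nat.card F ^ n := by
  rw [monicFinset, ← Set.ncard_eq_toFinset_card _ (finite_monicsOfDegree F n),
    ← Nat.card_coe_set_eq]
  have h : Nat.card (monicsOfDegree F n) = Nat.card (Fin n → F) :=
    Nat.card_congr ((monicEquivDegreeLT n).trans (degreeLTEquiv F n).toEquiv)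
  rw [h, Nat.card_fun]
  simp

open Classical in
variable (F) in
/-- The pairs `(P, i)` with `P` a monic prime, `deg P ≤ n` and `1 ≤ i ≤ n`. -/
def primePairsLE (n : ℕ) : Finset (F[X] × ℕ) :=
  ((Finset.Icc 1 n).biUnion (monicFinset F)).filter Irreducible ×ˢ Finset.Icc 1 n

open Classical in
variable (F) in
/-- The pairs `(P, i)` with `P` a monic prime, `i ≥ 1` and `deg (P ^ i) = j`. -/
def primePairs (j : ℕ) : Finset (F[X] × ℕ) :=
  (primePairsLE F j).filter fun x => x.2 * x.1.natDegree = j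

lemma mem_primePairsLE {n : ℕ} {x : F[X] × ℕ} :
    x ∈ primePairsLE F n ↔
      x.1.Monic ∧ Irreducible x.1 ∧ x.1.natDegree ≤ n ∧ 1 ≤ x.2 ∧ x.2 ≤ n := by
  simp only [primePairsLE, Finset.mem_product, Finset.mem_filter, Finset.mem_biUnion,
    Finset.mem_Icc, mem_monicFinset]
  constructor
  · rintro ⟨⟨⟨d, hd, hm, hdeg⟩, hirr⟩, h1, h2⟩
    exact ⟨hm, hirr, by omega, h1, h2⟩
  · rintro ⟨hm, hirr, hd, h1, h2⟩
    exact ⟨⟨⟨_, ⟨hirr.natDegree_pos, hd⟩, hm, rfl⟩, hirr⟩, h1, h2⟩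

lemma mem_primePairs {j : ℕ} {x : F[X] × ℕ} :
    x ∈ primePairs F j ↔
      x.1.Monic ∧ Irreducible x.1 ∧ 1 ≤ x.2 ∧ x.2 * x.1.natDegree = j := by
  rw [primePairs, Finset.mem_filter, mem_primePairsLE]
  constructor
  · rintro ⟨⟨hm, hirr, -, h1, -⟩, h2⟩
    exact ⟨hm, hirr, h1, h2⟩
  · rintro ⟨hm, hirr, h1, h2⟩
    have := hirr.natDegree_pos
    refine ⟨⟨hm, hirr, ?_, h1, ?_⟩, h2⟩ <;> nlinarith

open Classical in
/-- The degree of `f` is the sum of `deg P` over all prime powers `P ^ i` dividing `f`. -/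
lemma sum_natDegree_primePairs_dvd {n : ℕ} {f : F[X]} (hf : f ∈ monicFinset F n) :
    ∑ x ∈ (primePairsLE F n).filter (fun x => x.1 ^ x.2 ∣ f), x.1.natDegree = n := by
  obtain ⟨hm, hdeg⟩ := mem_monicFinset.1 hf
  have hf0 := hm.ne_zero
  set N := UniqueFactorizationMonoid.normalizedFactors f with hN
  have h1 : N.prod = f := by
    rw [hN, UniqueFactorizationMonoid.prod_normalizedFactors_eq hf0, hm.normalize_eq_self]
  have h2 : n = ∑ P ∈ N.toFinset, N.count P * P.natDegree := by
    have h3 := natDegree_multiset_prod N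
      (fun h => UniqueFactorizationMonoid.zero_notMem_normalizedFactors f h)
    rw [h1, hdeg, Finset.sum_multiset_map_count] at h3
    simpa using h3
  have hmem : ∀ P ∈ N, P.Monic ∧ Irreducible P ∧ P.natDegree ≤ n := by
    intro P hP
    obtain ⟨hirr, hnorm, hdvd⟩ := (UniqueFactorizationMonoid.mem_normalizedFactors_iff' hf0).1 hP
    refine ⟨?_, hirr, hdeg ▸ natDegree_le_of_dvd hdvd hf0⟩
    rw [← hnorm]
    exact monic_normalize hirr.ne_zero
  rw [Finset.sum_filter, primePairsLE, Finset.sum_product]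
  conv_rhs => rw [h2]
  symm
  refine Finset.sum_subset_zero_on_sdiff ?_ ?_ ?_
  · intro P hP
    obtain ⟨h3, h4, h5⟩ := hmem P (Multiset.mem_toFinset.1 hP)
    simp only [Finset.mem_filter, Finset.mem_biUnion, Finset.mem_Icc, mem_monicFinset]
    exact ⟨⟨_, ⟨h4.natDegree_pos, h5⟩, h3, rfl⟩, h4⟩
  · intro P hP
    simp only [Finset.mem_sdiff, Finset.mem_filter, Multiset.mem_toFinset, Finset.mem_biUnion,
      mem_monicFinset] at hP
    refine Finset.sum_eq_zero fun i hi => if_neg fun hdvd => hP.2 ?_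
    obtain ⟨⟨d, -, hPm, -⟩, hirr⟩ := hP.1
    refine (UniqueFactorizationMonoid.mem_normalizedFactors_iff' hf0).2
      ⟨hirr, hPm.normalize_eq_self, (dvd_pow_self P ?_).trans hdvd⟩
    rw [Finset.mem_Icc] at hi
    omega
  · intro P hP
    obtain ⟨hPm, hirr, hPd⟩ := hmem P (Multiset.mem_toFinset.1 hP)
    have hcount : N.count P ≤ n := by
      have h3 : N.count P * P.natDegree ≤ n := by
        conv_rhs => rw [h2]
        exact Finset.single_le_sum (f := fun P => N.count P * P.natDegree)
          (fun _ _ => Nat.zero_le _) hP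
      have := hirr.natDegree_pos
      nlinarith
    have hdv : ∀ i, P ^ i ∣ f ↔ i ≤ N.count P := by
      intro i
      rw [pow_dvd_iff_le_emultiplicity,
        UniqueFactorizationMonoid.emultiplicity_eq_count_normalizedFactors hirr hf0,
        hPm.normalize_eq_self]
      exact Nat.cast_le
    simp only [hdv]
    rw [← Finset.sum_filter, Finset.sum_const, smul_eq_mul]
    congr 1
    have : (Finset.Icc 1 n).filter (fun i => i ≤ N.count P) = Finset.Icc 1 (N.count P) := by
      ext i
      simp only [Finset.mem_filter, Finset.mem_Icc]
      omega
    rw [this, Nat.card_Icc]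
    omega

variable (F) in
/-- The generating polynomial of `Ω` over the monic polynomials of degree `n`. -/
def omegaSum (n : ℕ) : ℝ[X] := ∑ f ∈ monicFinset F n, X ^ bigOmega f

variable (F) in
/-- The sum of `deg P * X ^ i` over the prime powers `P ^ i` of degree `j`: the coefficients of the
logarithmic derivative of the generating function of `omegaSum`. -/
def primePowerSum (j : ℕ) : ℝ[X] := ∑ x ∈ primePairs F j, C (x.1.natDegree : ℝ) * X ^ x.2

/-- The logarithmic derivative of the Euler product, coefficientwise. -/
lemma natCast_mul_omegaSum (n : ℕ) :
    (n : ℝ[X]) * omegaSum F n =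
      ∑ ij ∈ antidiagonal n, primePowerSum F ij.1 * omegaSum F ij.2 := by
  classical
  have hL : (n : ℝ[X]) * omegaSum F n = ∑ y ∈ (monicFinset F n).sigma
      (fun f => (primePairsLE F n).filter (fun x => x.1 ^ x.2 ∣ f)),
      C (y.2.1.natDegree : ℝ) * X ^ bigOmega y.1 := by
    rw [Finset.sum_sigma, omegaSum, Finset.mul_sum]
    refine Finset.sum_congr rfl fun f hf => ?_
    simp only
    rw [← Finset.sum_mul]
    congr 1
    conv_lhs => rw [← sum_natDegree_primePairs_dvd hf]
    push_cast
    simp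
  have hR : ∑ ij ∈ antidiagonal n, primePowerSum F ij.1 * omegaSum F ij.2 =
      ∑ y ∈ (antidiagonal n).sigma (fun ij => primePairs F ij.1 ×ˢ monicFinset F ij.2),
      C (y.2.1.1.natDegree : ℝ) * X ^ y.2.1.2 * X ^ bigOmega y.2.2 := by
    rw [Finset.sum_sigma]
    refine Finset.sum_congr rfl fun ij _ => ?_
    rw [primePowerSum, omegaSum, Finset.sum_mul_sum, Finset.sum_product]
  rw [hL, hR]
  refine Finset.sum_bij'
    (fun y _ => ⟨(y.2.2 * y.2.1.natDegree, n - y.2.2 * y.2.1.natDegree),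
      (y.2, y.1 /ₘ (y.2.1 ^ y.2.2))⟩)
    (fun y _ => ⟨y.2.1.1 ^ y.2.1.2 * y.2.2, y.2.1⟩) ?_ ?_ ?_ ?_ ?_
  · rintro ⟨f, P, i⟩ h
    simp only [Finset.mem_sigma, Finset.mem_filter, mem_primePairsLE, mem_monicFinset] at h
    obtain ⟨⟨hfm, hfd⟩, ⟨hP, hirr, -, hi, -⟩, g, rfl⟩ := h
    have hg : g.Monic := (hP.pow i).of_mul_monic_left hfm
    rw [(hP.pow i).natDegree_mul hg, hP.natDegree_pow] at hfd
    simp only [Finset.mem_sigma, Finset.mem_product, mem_antidiagonal, mem_primePairs,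
      mem_monicFinset, mul_divByMonic_cancel_left _ (hP.pow i)]
    exact ⟨by omega, ⟨hP, hirr, hi, trivial⟩, hg, by omega⟩
  · rintro ⟨⟨a, b⟩, ⟨P, i⟩, g⟩ h
    simp only [Finset.mem_sigma, Finset.mem_product, mem_antidiagonal, mem_primePairs,
      mem_monicFinset] at h
    obtain ⟨hab, ⟨hP, hirr, hi, rfl⟩, hg, rfl⟩ := h
    have := hirr.natDegree_pos
    simp only [Finset.mem_sigma, Finset.mem_filter, mem_primePairsLE, mem_monicFinset]
    refine ⟨⟨(hP.pow i).mul hg, ?_⟩, ⟨hP, hirr, ?_, hi, ?_⟩, dvd_mul_right _ _⟩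
    · rw [(hP.pow i).natDegree_mul hg, hP.natDegree_pow, hab]
    · nlinarith
    · nlinarith
  · rintro ⟨f, P, i⟩ h
    simp only [Finset.mem_sigma, Finset.mem_filter, mem_primePairsLE, mem_monicFinset] at h
    obtain ⟨⟨hfm, hfd⟩, ⟨hP, hirr, -, hi, -⟩, g, rfl⟩ := h
    simp only [mul_divByMonic_cancel_left _ (hP.pow i)]
  · rintro ⟨⟨a, b⟩, ⟨P, i⟩, g⟩ h
    simp only [Finset.mem_sigma, Finset.mem_product, mem_antidiagonal, mem_primePairs,
      mem_monicFinset] at h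
    obtain ⟨hab, ⟨hP, hirr, hi, rfl⟩, hg, rfl⟩ := h
    simp only [mul_divByMonic_cancel_left _ (hP.pow i), ← hab, Nat.add_sub_cancel_left]
  · rintro ⟨f, P, i⟩ h
    simp only [Finset.mem_sigma, Finset.mem_filter, mem_primePairsLE, mem_monicFinset] at h
    obtain ⟨⟨hfm, hfd⟩, ⟨hP, hirr, -, hi, -⟩, g, rfl⟩ := h
    have hg : g.Monic := (hP.pow i).of_mul_monic_left hfm
    simp only [mul_divByMonic_cancel_left _ (hP.pow i)]
    rw [bigOmega_mul (hP.pow i).ne_zero hg.ne_zero, bigOmega_pow_of_irreducible hirr, pow_add,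
      mul_assoc]

lemma primePowerSum_zero : primePowerSum F 0 = 0 := by
  refine Finset.sum_eq_zero fun x hx => ?_
  obtain ⟨-, hirr, h1, h2⟩ := mem_primePairs.1 hx
  have := hirr.natDegree_pos
  exact absurd h2 (by positivity)

lemma omegaSum_zero : omegaSum F 0 = 1 := by
  have : monicFinset F 0 = {1} := by
    ext f
    rw [mem_monicFinset, Finset.mem_singleton]
    constructor
    · rintro ⟨h1, h2⟩; exact h1.natDegree_eq_zero.1 h2
    · rintro rfl; simp
  simp [omegaSum, this, bigOmega]

/-- The prime polynomial theorem in its exact form `∑_{d ∣ j} d π_d = q ^ j`. -/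
lemma sum_natDegree_primePairs {j : ℕ} (hj : 1 ≤ j) :
    ∑ x ∈ primePairs F j, (x.1.natDegree : ℝ) = (Nat.card F : ℝ) ^ j := by
  set q : ℝ := (Nat.card F : ℝ) with hq
  set c : ℕ → ℝ := fun j => ∑ x ∈ primePairs F j, (x.1.natDegree : ℝ) with hc
  have hM : ∀ n, (omegaSum F n).eval 1 = q ^ n := fun n => by
    simp [omegaSum, eval_finsetSum, card_monicFinset, hq]
  have hC : ∀ n, (primePowerSum F n).eval 1 = c n := fun n => by
    simp [primePowerSum, eval_finsetSum, hc]
  have hrec : ∀ n : ℕ, (n : ℝ) * q ^ n = ∑ ij ∈ antidiagonal n, c ij.1 * q ^ ij.2 := by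
    intro n
    have := congrArg (eval 1) (natCast_mul_omegaSum (F := F) n)
    simpa [eval_finsetSum, hM, hC] using this
  obtain ⟨m, rfl⟩ : ∃ m, j = m + 1 := ⟨j - 1, by omega⟩
  have h1 := hrec (m + 1)
  rw [Finset.Nat.sum_antidiagonal_succ'] at h1
  simp only [pow_zero, mul_one] at h1
  have h2 : ∑ p ∈ antidiagonal m, c p.1 * q ^ (p.2 + 1) = m * q ^ m * q := by
    rw [hrec m, Finset.sum_mul]
    exact Finset.sum_congr rfl fun p _ => by ring
  rw [h2] at h1
  show c (m + 1) = _
  have h3 : ((m + 1 : ℕ) : ℝ) * q ^ (m + 1) = m * q ^ m * q + q ^ (m + 1) := by push_cast; ring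
  linarith

/-- The probability generating polynomial of `Ω` on monic polynomials of degree `n`. -/
lemma coeff_omegaSum (n k : ℕ) :
    (omegaSum F n).coeff k / (Nat.card F : ℝ) ^ n = probOmega F n k := by
  classical
  rw [omegaSum, finsetSum_coeff, probOmega, uniformProb]
  simp only [coeff_X_pow]
  rw [Finset.sum_boole]
  congr 1
  · rw [← Set.ncard_coe_finset]
    congr 2
    ext f
    simp [mem_monicFinset, monicsOfDegree, eq_comm]
  · have := card_monicFinset F n
    rw [monicFinset, ← Set.ncard_eq_toFinset_card _ (finite_monicsOfDegree F n)] at this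
    rw [this]; push_cast; rfl
end

/-! ### Weighted norms of power series and the saddle point -/

/-- The weighted `ℓ¹` norm `∑ |a_j| R ^ j` of the power series `∑ a_j z ^ j` is at most `B`. -/
def NormLE (R : ℝ) (f : ℝ⟦X⟧) (B : ℝ) : Prop :=
  ∀ M : ℕ, ∑ j ∈ Finset.range M, |PowerSeries.coeff j f| * R ^ j ≤ B

section
variable {R : ℝ} {f g : ℝ⟦X⟧} {A B : ℝ}

lemma NormLE.nonneg (h : NormLE R f B) : 0 ≤ B := by simpa using h 0

lemma NormLE.mono (h : NormLE R f A) (hAB : A ≤ B) : NormLE R f B := fun M => (h M).trans hAB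

lemma NormLE.of_le {S : ℝ} (h : NormLE S f B) (hR : 0 ≤ R) (hRS : R ≤ S) : NormLE R f B :=
  fun M => le_trans (Finset.sum_le_sum fun j _ => by gcongr) (h M)

lemma NormLE.coeff_le (h : NormLE R f B) (hR : 0 ≤ R) (j : ℕ) :
    |PowerSeries.coeff j f| * R ^ j ≤ B :=
  le_trans (Finset.single_le_sum (f := fun j => |PowerSeries.coeff j f| * R ^ j)
    (fun i _ => by positivity) (Finset.self_mem_range_succ j)) (h (j + 1))

lemma NormLE.add (hf : NormLE R f A) (hR : 0 ≤ R) (hg : NormLE R g B) :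
    NormLE R (f + g) (A + B) := by
  intro M
  refine le_trans ?_ (add_le_add (hf M) (hg M))
  rw [← Finset.sum_add_distrib]
  refine Finset.sum_le_sum fun j _ => ?_
  rw [← add_mul, map_add]
  gcongr
  exact abs_add_le _ _

lemma NormLE.neg (hf : NormLE R f A) : NormLE R (-f) A := by
  intro M
  simpa using hf M

lemma NormLE.sub (hf : NormLE R f A) (hR : 0 ≤ R) (hg : NormLE R g B) :
    NormLE R (f - g) (A + B) := by
  rw [sub_eq_add_neg]; exact hf.add hR hg.neg

lemma NormLE.mul (hf : NormLE R f A) (hR : 0 ≤ R) (hg : NormLE R g B) :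
    NormLE R (f * g) (A * B) := by
  intro M
  refine le_trans ?_ (mul_le_mul (hf M) (hg M)
    (Finset.sum_nonneg fun i _ => by positivity) hf.nonneg)
  rw [Finset.sum_mul_sum, ← Finset.sum_product']
  have h1 : ∀ n ∈ Finset.range M, |PowerSeries.coeff n (f * g)| * R ^ n ≤
      ∑ x ∈ antidiagonal n, |PowerSeries.coeff x.1 f| * R ^ x.1 *
        (|PowerSeries.coeff x.2 g| * R ^ x.2) := by
    intro n _
    rw [PowerSeries.coeff_mul]
    refine le_trans (mul_le_mul_of_nonneg_right (Finset.abs_sum_le_sum_abs _ _) (by positivity)) ?_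
    rw [Finset.sum_mul]
    refine Finset.sum_le_sum fun x hx => le_of_eq ?_
    rw [abs_mul, ← mem_antidiagonal.1 hx, pow_add]
    ring
  refine (Finset.sum_le_sum h1).trans ?_
  rw [Finset.sum_sigma']
  refine le_of_eq_of_le (Finset.sum_nbij' (t := (Finset.range M ×ˢ Finset.range M).filter
    (fun x => x.1 + x.2 < M)) (g := fun x : ℕ × ℕ => |PowerSeries.coeff x.1 f| * R ^ x.1 *
        (|PowerSeries.coeff x.2 g| * R ^ x.2)) (fun y => y.2) (fun x => ⟨x.1 + x.2, x⟩)
      ?_ ?_ ?_ ?_ ?_) ?_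
  · rintro ⟨n, i, j⟩ h
    simp only [Finset.mem_sigma, Finset.mem_range, mem_antidiagonal, Finset.mem_filter,
      Finset.mem_product] at h ⊢
    omega
  · rintro ⟨i, j⟩ h
    simp only [Finset.mem_sigma, Finset.mem_range, mem_antidiagonal, Finset.mem_filter,
      Finset.mem_product] at h ⊢
    exact ⟨h.2, trivial⟩
  · rintro ⟨n, i, j⟩ h
    simp only [Finset.mem_sigma, Finset.mem_range, mem_antidiagonal] at h
    obtain ⟨-, rfl⟩ := h
    rfl
  · rintro ⟨i, j⟩ h; rfl
  · rintro ⟨n, i, j⟩ h; rfl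
  · exact Finset.sum_le_sum_of_subset_of_nonneg (Finset.filter_subset _ _)
      fun x _ _ => by positivity

lemma normLE_monomial (hR : 0 ≤ R) (i : ℕ) (a : ℝ) :
    NormLE R (PowerSeries.monomial i a) (|a| * R ^ i) := by
  intro M
  have h : ∀ j, |PowerSeries.coeff j (PowerSeries.monomial i a)| * R ^ j =
      if j = i then |a| * R ^ i else 0 := by
    intro j
    rw [PowerSeries.coeff_monomial]
    split_ifs with h
    · rw [h]
    · simp
  simp only [h]
  rw [Finset.sum_ite_eq']
  split_ifs
  · exact le_rfl
  · positivity

lemma NormLE.sum {ι : Type*} {s : Finset ι} {f : ι → ℝ⟦X⟧} {B : ι → ℝ} (hR : 0 ≤ R)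
    (h : ∀ i ∈ s, NormLE R (f i) (B i)) : NormLE R (∑ i ∈ s, f i) (∑ i ∈ s, B i) := by
  classical
  induction s using Finset.induction_on with
  | empty => intro M; simp
  | insert a s ha ih =>
    rw [Finset.sum_insert ha, Finset.sum_insert ha]
    exact (h a (Finset.mem_insert_self a s)).add hR
      (ih fun i hi => h i (Finset.mem_insert_of_mem hi))

lemma NormLE.prod {ι : Type*} {s : Finset ι} {f : ι → ℝ⟦X⟧} {B : ι → ℝ} (hR : 0 ≤ R)
    (h : ∀ i ∈ s, NormLE R (f i) (B i)) : NormLE R (∏ i ∈ s, f i) (∏ i ∈ s, B i) := by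
  classical
  induction s using Finset.induction_on with
  | empty => simpa using normLE_monomial hR 0 1
  | insert a s ha ih =>
    rw [Finset.prod_insert ha, Finset.prod_insert ha]
    exact (h a (Finset.mem_insert_self a s)).mul hR
      (ih fun i hi => h i (Finset.mem_insert_of_mem hi))

lemma NormLE.smul (hf : NormLE R f A) (c : ℝ) : NormLE R (c • f) (|c| * A) := by
  intro M
  refine le_trans (le_of_eq ?_) (mul_le_mul_of_nonneg_left (hf M) (abs_nonneg c))
  rw [Finset.mul_sum]
  refine Finset.sum_congr rfl fun j _ => ?_
  rw [PowerSeries.coeff_smul, smul_eq_mul, abs_mul, mul_assoc]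

lemma NormLE.of_X_mul (hR : 0 < R) (h : NormLE R (PowerSeries.X * f) A) : NormLE R f (A / R) := by
  intro M
  rw [le_div_iff₀ hR]
  refine le_trans (le_of_eq ?_) (h (M + 1))
  rw [Finset.sum_range_succ', Finset.sum_mul]
  simp only [PowerSeries.coeff_succ_X_mul, PowerSeries.coeff_zero_X_mul, abs_zero, zero_mul,
    add_zero]
  exact Finset.sum_congr rfl fun j _ => by ring

lemma NormLE.abs_eval_le {p : ℝ[X]} (h : NormLE R (p : ℝ⟦X⟧) A) (hR : 0 ≤ R) :
    |p.eval R| ≤ A := by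
  refine le_trans ?_ (h (p.natDegree + 1))
  rw [eval_eq_sum_range]
  refine (Finset.abs_sum_le_sum_abs _ _).trans (le_of_eq (Finset.sum_congr rfl fun j _ => ?_))
  rw [abs_mul, abs_pow, abs_of_nonneg hR, Polynomial.coeff_coe]
end

lemma normLE_one {R : ℝ} (hR : 0 ≤ R) : NormLE R (1 : ℝ⟦X⟧) 1 := by
  simpa using normLE_monomial hR 0 1

lemma normLE_C_mul_X {R : ℝ} (hR : 0 ≤ R) {a : ℝ} (ha : 0 ≤ a) :
    NormLE R (PowerSeries.C a * PowerSeries.X) (a * R) := by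
  have := normLE_monomial hR 1 a
  rwa [abs_of_nonneg ha, pow_one, PowerSeries.monomial_eq_C_mul_X_pow, pow_one] at this

/-- The power series `e ^ (a z)`. -/
def expSeries (a : ℝ) : ℝ⟦X⟧ := PowerSeries.rescale a (PowerSeries.exp ℝ)

lemma coeff_expSeries (a : ℝ) (j : ℕ) :
    PowerSeries.coeff j (expSeries a) = a ^ j / j.factorial := by
  simp [expSeries, PowerSeries.coeff_rescale, PowerSeries.coeff_exp, div_eq_mul_inv]

lemma expSeries_add (a b : ℝ) : expSeries (a + b) = expSeries a * expSeries b :=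
  (PowerSeries.exp_mul_exp_eq_exp_add a b).symm

lemma expSeries_zero : expSeries 0 = 1 := by
  simp [expSeries]

lemma expSeries_sum {ι : Type*} (s : Finset ι) (a : ι → ℝ) :
    expSeries (∑ i ∈ s, a i) = ∏ i ∈ s, expSeries (a i) := by
  classical
  induction s using Finset.induction_on with
  | empty => simp [expSeries_zero]
  | insert b s hb ih => rw [Finset.sum_insert hb, Finset.prod_insert hb, expSeries_add, ih]

lemma normLE_expSeries {R : ℝ} (hR : 0 ≤ R) (a : ℝ) :
    NormLE R (expSeries a) (Real.exp (|a| * R)) := by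
  intro M
  refine le_trans (le_of_eq (Finset.sum_congr rfl fun j _ => ?_))
    (Real.sum_le_exp_of_nonneg (by positivity) M)
  rw [coeff_expSeries, abs_div, abs_pow, Nat.abs_cast, mul_pow]
  ring

/-- A form of `j r ^ (j - 1) ε ≤ (r + ε) ^ j` free of subtraction: derivatives at radius `r` are
controlled by the norm at radius `r + ε`. -/
lemma mul_pow_mul_le {r ε : ℝ} (hr : 0 ≤ r) (hε : 0 ≤ ε) (j : ℕ) :
    (j : ℝ) * r ^ j * ε ≤ r * (r + ε) ^ j := by
  induction j with
  | zero => simpa using hr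
  | succ j ih =>
    have h1 : r ^ j ≤ (r + ε) ^ j := by gcongr; linarith
    have h2 : r * (j * r ^ j * ε) ≤ r * (r * (r + ε) ^ j) := by gcongr
    have h3 : r * ε * r ^ j ≤ r * ε * (r + ε) ^ j := by gcongr
    push_cast
    calc ((j : ℝ) + 1) * r ^ (j + 1) * ε = r * (j * r ^ j * ε) + r * ε * r ^ j := by ring
      _ ≤ r * (r * (r + ε) ^ j) + r * ε * (r + ε) ^ j := add_le_add h2 h3
      _ = r * (r + ε) ^ (j + 1) := by ring

/-- The coefficient extraction at the saddle point. Since `K = r L`, the factor `z - r` kills the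
main term of the coefficient of `z ^ K` in `e ^ (L z) V(z)`, which saves a factor `r / L`. -/
lemma abs_coeff_expSeries_mul_sub_le {L r ε N : ℝ} {K : ℕ} (hL : 0 < L) (hr : r = K / L)
    (hε : 0 < ε) {V : ℝ⟦X⟧} (hV : NormLE (r + ε) V N) :
    |PowerSeries.coeff K (expSeries L * (PowerSeries.X - PowerSeries.C r) * V)| ≤
      L ^ K / K.factorial * (r / L) * (N / ε) := by
  have hr0 : 0 ≤ r := by rw [hr]; positivity
  have h1 : ∀ i, PowerSeries.coeff i (expSeries L * (PowerSeries.X - PowerSeries.C r)) =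
      L ^ i / i.factorial * (i / L - r) := by
    intro i
    rw [mul_sub, map_sub, PowerSeries.coeff_mul_C, coeff_expSeries]
    cases i with
    | zero => simp
    | succ i =>
      rw [PowerSeries.coeff_succ_mul_X, coeff_expSeries, Nat.factorial_succ]
      push_cast
      have := Nat.factorial_pos i
      field_simp
      ring
  have h2 : ∀ x ∈ antidiagonal K,
      |PowerSeries.coeff x.1 (expSeries L * (PowerSeries.X - PowerSeries.C r)) *
        PowerSeries.coeff x.2 V| ≤
      L ^ K / K.factorial * (r / L) / ε * (|PowerSeries.coeff x.2 V| * (r + ε) ^ x.2) := by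
    rintro ⟨i, j⟩ hx
    simp only [mem_antidiagonal] at hx ⊢
    rw [h1, abs_mul, abs_mul, abs_of_nonneg (by positivity : (0 : ℝ) ≤ L ^ i / i.factorial)]
    have h3 : |(i : ℝ) / L - r| = j / L := by
      have : (i : ℝ) / L - r = -(j / L) := by
        rw [hr, ← hx]; push_cast; ring
      rw [this, abs_neg, abs_of_nonneg (by positivity)]
    have h4 : L ^ i / i.factorial ≤ L ^ K / K.factorial * r ^ j := by
      have h5 : (K.factorial : ℝ) ≤ i.factorial * (K : ℝ) ^ j := by
        have h6 : K.factorial ≤ i.factorial * K ^ j := by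
          rw [← Nat.factorial_mul_descFactorial (by omega : j ≤ K), ← hx, Nat.add_sub_cancel]
          exact Nat.mul_le_mul_left _ (Nat.descFactorial_le_pow _ _)
        exact_mod_cast h6
      rw [hr, div_pow, div_le_iff₀ (by positivity)]
      have h7 : L ^ K = L ^ i * L ^ j := by rw [← hx, pow_add]
      rw [h7]
      calc L ^ i = L ^ i / K.factorial * K.factorial := by field_simp
        _ ≤ L ^ i / K.factorial * (i.factorial * (K : ℝ) ^ j) := by gcongr
        _ = _ := by field_simp
    have h8 := mul_pow_mul_le hr0 hε.le j
    rw [h3]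
    calc L ^ i / i.factorial * (j / L) * |PowerSeries.coeff j V|
        ≤ L ^ K / K.factorial * r ^ j * (j / L) * |PowerSeries.coeff j V| := by gcongr
      _ = L ^ K / K.factorial / L / ε * |PowerSeries.coeff j V| * (j * r ^ j * ε) := by
          field_simp
      _ ≤ L ^ K / K.factorial / L / ε * |PowerSeries.coeff j V| * (r * (r + ε) ^ j) := by gcongr
      _ = _ := by ring
  rw [PowerSeries.coeff_mul]
  refine (Finset.abs_sum_le_sum_abs _ _).trans ((Finset.sum_le_sum h2).trans ?_)
  rw [← Finset.mul_sum, Finset.Nat.sum_antidiagonal_eq_sum_range_succ_mk]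
  simp only
  have h9 := Finset.sum_range_reflect (fun j => |PowerSeries.coeff j V| * (r + ε) ^ j) (K + 1)
  simp only [Nat.add_sub_cancel] at h9
  rw [Nat.succ_eq_add_one, h9]
  calc _ ≤ L ^ K / K.factorial * (r / L) / ε * N := by gcongr; exact hV _
    _ = _ := by ring

/-- The divided difference of a polynomial at `r`, with its norm. -/
lemma exists_sub_eval_eq_mul {r R ε N : ℝ} (hr : 0 ≤ r) (hrR : r ≤ R) (hε : 0 < ε) {p : ℝ[X]}
    (hp : NormLE (R + ε) (p : ℝ⟦X⟧) N) :
    ∃ Q : ℝ[X], p - C (p.eval r) = (X - C r) * Q ∧ NormLE R (Q : ℝ⟦X⟧) (N / ε) := by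
  have hR : 0 ≤ R := hr.trans hrR
  refine ⟨∑ j ∈ Finset.range (p.natDegree + 1), ∑ i ∈ Finset.range j,
    Polynomial.monomial i (p.coeff j * r ^ (j - 1 - i)), ?_, ?_⟩
  · have h1 : ∀ j, (X - C r) * ∑ i ∈ Finset.range j,
        Polynomial.monomial i (p.coeff j * r ^ (j - 1 - i)) =
        C (p.coeff j) * X ^ j - C (p.coeff j * r ^ j) := by
      intro j
      have h2 := (Commute.all (X : ℝ[X]) (C r)).mul_geom_sum₂ j
      have h3 : ∑ i ∈ Finset.range j, Polynomial.monomial i (p.coeff j * r ^ (j - 1 - i)) =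
          C (p.coeff j) * ∑ i ∈ Finset.range j, X ^ i * (C r) ^ (j - 1 - i) := by
        rw [Finset.mul_sum]
        refine Finset.sum_congr rfl fun i _ => ?_
        rw [← C_mul_X_pow_eq_monomial, C_mul, C_pow]
        ring
      rw [h3, mul_left_comm, h2, C_mul, C_pow]
      ring
    rw [Finset.mul_sum, Finset.sum_congr rfl fun j _ => h1 j, Finset.sum_sub_distrib,
      ← map_sum, ← eval_eq_sum_range, ← p.as_sum_range_C_mul_X_pow]
  · have h1 : ∀ j ∈ Finset.range (p.natDegree + 1), NormLE R
        ((∑ i ∈ Finset.range j, Polynomial.monomial i (p.coeff j * r ^ (j - 1 - i)) : ℝ[X]) : ℝ⟦X⟧)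
        (|PowerSeries.coeff j (p : ℝ⟦X⟧)| * (R + ε) ^ j / ε) := by
      intro j _
      have h2 : ((∑ i ∈ Finset.range j,
          Polynomial.monomial i (p.coeff j * r ^ (j - 1 - i)) : ℝ[X]) : ℝ⟦X⟧) =
          ∑ i ∈ Finset.range j, PowerSeries.monomial i (p.coeff j * r ^ (j - 1 - i)) := by
        rw [← Polynomial.coeToPowerSeries.ringHom_apply, map_sum]
        simp
      rw [h2]
      refine (NormLE.sum hR fun i _ => normLE_monomial hR i _).mono ?_
      have h3 := (Commute.all (R + ε) R).mul_geom_sum₂ j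
      rw [Polynomial.coeff_coe, mul_div_assoc]
      have h4 : ∑ i ∈ Finset.range j, |p.coeff j * r ^ (j - 1 - i)| * R ^ i ≤
          |p.coeff j| * ∑ i ∈ Finset.range j, (R + ε) ^ i * R ^ (j - 1 - i) := by
        rw [Finset.mul_sum]
        refine Finset.sum_le_sum fun i _ => ?_
        rw [abs_mul, abs_of_nonneg (pow_nonneg hr _), mul_assoc, mul_comm ((R + ε) ^ i)]
        gcongr
        linarith
      refine h4.trans ?_
      gcongr
      rw [le_div_iff₀ hε]
      have h5 : 0 ≤ R ^ j := by positivity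
      calc _ = (R + ε - R) * ∑ i ∈ Finset.range j, (R + ε) ^ i * R ^ (j - 1 - i) := by ring
        _ ≤ (R + ε) ^ j := by rw [h3]; linarith
    have h6 : ((∑ j ∈ Finset.range (p.natDegree + 1), ∑ i ∈ Finset.range j,
        Polynomial.monomial i (p.coeff j * r ^ (j - 1 - i)) : ℝ[X]) : ℝ⟦X⟧) =
        ∑ j ∈ Finset.range (p.natDegree + 1), ((∑ i ∈ Finset.range j,
        Polynomial.monomial i (p.coeff j * r ^ (j - 1 - i)) : ℝ[X]) : ℝ⟦X⟧) := by
      rw [← Polynomial.coeToPowerSeries.ringHom_apply, map_sum]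
      rfl
    rw [h6]
    refine (NormLE.sum hR h1).mono ?_
    rw [← Finset.sum_div]
    gcongr
    exact hp _

/-! ### The generating polynomial of the number of cycles near the saddle point -/

/-- The norm of `(1 + z) e ^ (-z)` at radius `y ≤ 1`: since `(j - 1) / j! = 1 / (j - 1)! - 1 / j!`,
the sum telescopes. -/
lemma sum_range_sub_one_div_factorial_le (y : ℝ) (hy : 0 ≤ y) (hy1 : y ≤ 1) (M : ℕ) :
    ∑ j ∈ Finset.range (M + 2), y ^ j * |1 - (j : ℝ)| / j.factorial ≤
      1 + y ^ 2 * (1 - 1 / (M + 1).factorial) := by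
  induction M with
  | zero => simp [Finset.sum_range_succ]
  | succ M ih =>
    rw [Finset.sum_range_succ]
    have h1 : |1 - ((M + 2 : ℕ) : ℝ)| = M + 1 := by
      push_cast
      rw [abs_of_nonpos (by linarith [(Nat.cast_nonneg M : (0 : ℝ) ≤ M)])]
      ring
    have h2 : y ^ (M + 2) ≤ y ^ 2 := pow_le_pow_of_le_one hy hy1 (by omega)
    have h3 : ((M + 2).factorial : ℝ) = (M + 2) * (M + 1).factorial := by
      rw [Nat.factorial_succ]; push_cast; ring
    have h4 : (0 : ℝ) < (M + 1).factorial := by positivity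
    have h5 : y ^ (M + 2) * (M + 1) / ((M + 2).factorial : ℝ) ≤
        y ^ 2 * (1 / (M + 1).factorial - 1 / (M + 2).factorial) := by
      have : (1 : ℝ) / (M + 1).factorial - 1 / (M + 2).factorial =
          (M + 1) / (M + 2).factorial := by
        rw [h3]; field_simp; ring
      rw [this, mul_div_assoc]
      gcongr
    rw [h1]
    calc _ ≤ 1 + y ^ 2 * (1 - 1 / (M + 1).factorial) +
        y ^ 2 * (1 / (M + 1).factorial - 1 / (M + 2).factorial) := add_le_add ih h5
      _ = _ := by ring

/-- The factor `(1 + a z) e ^ (-a z)` has no linear term, so its norm is `1 + O(y ^ 2)` for small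
`y = a R`, while it is at most `e ^ (2 y)` always. -/
lemma normLE_one_add_mul_expSeries {R a : ℝ} (hR : 0 ≤ R) (ha : 0 ≤ a) :
    NormLE R ((1 + PowerSeries.C a * PowerSeries.X) * expSeries (-a))
      (Real.exp (4 * ((a * R) ^ 2 / (1 + a * R)))) := by
  have hy : 0 ≤ a * R := by positivity
  rcases le_total (a * R) 1 with h1 | h1
  · intro M
    have h2 : ∀ j, |PowerSeries.coeff j ((1 + PowerSeries.C a * PowerSeries.X) * expSeries (-a))| *
        R ^ j = (a * R) ^ j * |1 - (j : ℝ)| / j.factorial := by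
      intro j
      have h3 : PowerSeries.coeff j ((1 + PowerSeries.C a * PowerSeries.X) * expSeries (-a)) =
          (-a) ^ j * (1 - j) / j.factorial := by
        rw [add_mul, one_mul, map_add, mul_assoc, PowerSeries.coeff_C_mul, coeff_expSeries]
        cases j with
        | zero => simp
        | succ j =>
          rw [PowerSeries.coeff_succ_X_mul, coeff_expSeries, Nat.factorial_succ]
          push_cast
          have := Nat.factorial_pos j
          field_simp
          ring
      rw [h3, abs_div, abs_mul, abs_pow, abs_neg, abs_of_nonneg ha, Nat.abs_cast]
      ring
    simp only [h2]
    calc ∑ j ∈ Finset.range M, (a * R) ^ j * |1 - (j : ℝ)| / j.factorial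
        ≤ ∑ j ∈ Finset.range (M + 2), (a * R) ^ j * |1 - (j : ℝ)| / j.factorial :=
          Finset.sum_le_sum_of_subset_of_nonneg
            (Finset.range_subset_range.2 (by omega)) fun _ _ _ => by positivity
      _ ≤ 1 + (a * R) ^ 2 * (1 - 1 / (M + 1).factorial) :=
          sum_range_sub_one_div_factorial_le _ hy h1 M
      _ ≤ (a * R) ^ 2 + 1 := by
          have : (0 : ℝ) ≤ (a * R) ^ 2 * (1 / (M + 1).factorial) := by positivity
          linarith
      _ ≤ Real.exp ((a * R) ^ 2) := Real.add_one_le_exp _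
      _ ≤ _ := by
          gcongr
          rw [← mul_div_assoc, le_div_iff₀ (by positivity)]
          nlinarith [sq_nonneg (a * R)]
  · refine (((normLE_one hR).add hR (normLE_C_mul_X hR ha)).mul hR
      (normLE_expSeries hR (-a))).mono ?_
    rw [abs_neg, abs_of_nonneg ha]
    calc (1 + a * R) * Real.exp (a * R) ≤ Real.exp (a * R) * Real.exp (a * R) := by
          gcongr
          linarith [Real.add_one_le_exp (a * R)]
      _ = Real.exp (2 * (a * R)) := by rw [← Real.exp_add]; ring_nf
      _ ≤ _ := by
          apply Real.exp_le_exp.2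
          rw [← mul_div_assoc, le_div_iff₀ (by positivity)]
          nlinarith

lemma sum_inv_le_one_add_log (M : ℕ) : ∑ i ∈ Finset.range M, ((i : ℝ) + 1)⁻¹ ≤ 1 + Real.log M := by
  have := harmonic_le_one_add_log M
  simpa [harmonic] using this

lemma log_add_one_le_sum_inv (M : ℕ) :
    Real.log (M + 1) ≤ ∑ i ∈ Finset.range M, ((i : ℝ) + 1)⁻¹ := by
  have := log_add_one_le_harmonic M
  simpa [harmonic] using this

lemma sum_inv_sub_inv_add_le (N M : ℕ) :
    ∑ i ∈ Finset.range N, (((i : ℝ) + 1)⁻¹ - ((i : ℝ) + 1 + M)⁻¹) ≤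
      ∑ i ∈ Finset.range M, ((i : ℝ) + 1)⁻¹ := by
  have h1 := Finset.sum_range_add (fun i : ℕ => ((i : ℝ) + 1)⁻¹) M N
  have h2 : ∑ i ∈ Finset.range N, ((i : ℝ) + 1)⁻¹ ≤
      ∑ i ∈ Finset.range (M + N), ((i : ℝ) + 1)⁻¹ :=
    Finset.sum_le_sum_of_subset_of_nonneg
      (Finset.range_subset_range.2 (by omega)) fun _ _ _ => by positivity
  rw [Finset.sum_sub_distrib]
  have h3 : ∑ i ∈ Finset.range N, ((i : ℝ) + 1 + M)⁻¹ =
      ∑ i ∈ Finset.range N, (((M + i : ℕ) : ℝ) + 1)⁻¹ :=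
    Finset.sum_congr rfl fun i _ => by push_cast; ring_nf
  rw [h3]
  linarith

/-- With `M = ⌈R⌉` the sum is at most `M ∑ (1 / i - 1 / (i + M))`, which telescopes to at most `M`
times the harmonic number of `M`, uniformly in `N`. -/
lemma sum_sq_div_one_add_le {R : ℝ} (hR : 0 ≤ R) (N : ℕ) :
    ∑ i ∈ Finset.range N, (((i : ℝ) + 1)⁻¹ * R) ^ 2 / (1 + ((i : ℝ) + 1)⁻¹ * R) ≤
      (R + 1) * (1 + Real.log (R + 1)) := by
  rcases hR.eq_or_lt with rfl | hR0
  · simp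
  set M := ⌈R⌉₊ with hM
  have hRM : R ≤ M := Nat.le_ceil R
  have hMR : (M : ℝ) ≤ R + 1 := (Nat.ceil_lt_add_one hR).le
  have hM0 : (1 : ℝ) ≤ M := by exact_mod_cast Nat.ceil_pos.2 hR0
  calc _ ≤ ∑ i ∈ Finset.range N, (M : ℝ) * (((i : ℝ) + 1)⁻¹ - ((i : ℝ) + 1 + M)⁻¹) := by
        refine Finset.sum_le_sum fun i _ => ?_
        have hc : (0 : ℝ) < (i : ℝ) + 1 := by positivity
        set c : ℝ := (i : ℝ) + 1
        have h1 : (c⁻¹ * R) ^ 2 / (1 + c⁻¹ * R) = R ^ 2 / (c * (c + R)) := by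
          field_simp
        have h2 : (M : ℝ) * (c⁻¹ - (c + M)⁻¹) = (M : ℝ) ^ 2 / (c * (c + M)) := by
          field_simp; ring
        rw [h1, h2, div_le_div_iff₀ (by positivity) (by positivity)]
        have h3 : R ^ 2 * c ≤ M ^ 2 * c := by gcongr
        have h4 : R * M * R ≤ R * M * M := by gcongr
        nlinarith
    _ ≤ M * (1 + Real.log M) := by
        rw [← Finset.mul_sum]
        gcongr
        exact (sum_inv_sub_inv_add_le N M).trans (sum_inv_le_one_add_log M)
    _ ≤ _ := by
        have := Real.log_nonneg hM0
        gcongr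

/-- The power series `W` with `n A_n(z) / z = e ^ (z log n) W(z)`, where `A_n` is the probability
generating polynomial of the number of cycles and `n = N + 1`. -/
def cycleCorrection (N : ℕ) : ℝ⟦X⟧ :=
  (∏ i ∈ Finset.range N,
    ((1 + PowerSeries.C ((i : ℝ) + 1)⁻¹ * PowerSeries.X) * expSeries (-((i : ℝ) + 1)⁻¹))) *
  expSeries (∑ i ∈ Finset.range N, ((i : ℝ) + 1)⁻¹ - Real.log (N + 1))

/-- The bound does not depend on `N`. It is of the form `e ^ (O(R log R))` for large `R`, which is
the origin of the factor `(r + 1) ^ (C r)` in the error term. -/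
lemma normLE_cycleCorrection {R : ℝ} (hR : 0 ≤ R) (N : ℕ) :
    NormLE R (cycleCorrection N)
      (Real.exp (4 * ((R + 1) * (1 + Real.log (R + 1))) + R)) := by
  have h0 : NormLE R (∏ i ∈ Finset.range N, ((1 + PowerSeries.C ((i : ℝ) + 1)⁻¹ * PowerSeries.X) *
      expSeries (-((i : ℝ) + 1)⁻¹))) (∏ i ∈ Finset.range N, Real.exp (4 *
        ((((i : ℝ) + 1)⁻¹ * R) ^ 2 / (1 + ((i : ℝ) + 1)⁻¹ * R)))) :=
    NormLE.prod hR fun i _ => normLE_one_add_mul_expSeries hR (by positivity)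
  refine (h0.mul hR (normLE_expSeries hR _)).mono ?_
  rw [← Real.exp_sum, ← Finset.mul_sum, ← Real.exp_add]
  have h1 : |∑ i ∈ Finset.range N, ((i : ℝ) + 1)⁻¹ - Real.log (N + 1)| ≤ 1 := by
    have h2 := log_add_one_le_sum_inv N
    have h3 := sum_inv_le_one_add_log N
    have h4 : Real.log N ≤ Real.log (N + 1) := by
      rcases Nat.eq_zero_or_pos N with rfl | hN
      · simp
      · have : (0 : ℝ) < N := by exact_mod_cast hN
        exact Real.log_le_log this (by linarith)
    rw [abs_of_nonneg (by linarith)]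
    linarith
  have h5 := sum_sq_div_one_add_le hR N
  have h6 := mul_le_mul_of_nonneg_right h1 hR
  gcongr
  linarith

lemma expSeries_log_mul_cycleCorrection (N : ℕ) :
    expSeries (Real.log (N + 1)) * cycleCorrection N =
      ∏ i ∈ Finset.range N, (1 + PowerSeries.C ((i : ℝ) + 1)⁻¹ * PowerSeries.X) := by
  have h : ∀ a b c d : ℝ⟦X⟧, a * (b * c * d) = b * (a * c * d) := fun a b c d => by ring
  rw [cycleCorrection, Finset.prod_mul_distrib, ← expSeries_sum, h, ← expSeries_add,
    ← expSeries_add, Finset.sum_neg_distrib]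
  have h' : ∀ a b : ℝ, a + -b + (b - a) = 0 := fun a b => by ring
  rw [h', expSeries_zero, mul_one]

lemma coe_cyclePoly_succ (N : ℕ) :
    (cyclePoly (N + 1) : ℝ⟦X⟧) = PowerSeries.C ((N : ℝ) + 1)⁻¹ * PowerSeries.X *
      ∏ i ∈ Finset.range N, (1 + PowerSeries.C ((i : ℝ) + 1)⁻¹ * PowerSeries.X) := by
  induction N with
  | zero => simp [cyclePoly_succ, cyclePoly_zero]
  | succ N ih =>
    rw [cyclePoly_succ, Polynomial.coe_mul, ih, Finset.prod_range_succ]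
    push_cast
    have h : (PowerSeries.X + PowerSeries.C ((N : ℝ) + 1)) * PowerSeries.C ((N : ℝ) + 1)⁻¹ =
        1 + PowerSeries.C ((N : ℝ) + 1)⁻¹ * PowerSeries.X := by
      rw [add_mul, ← map_mul, mul_inv_cancel₀ (by positivity), map_one]
      ring
    rw [← h]
    ring

/-- Replacing a polynomial `p(z)` by its value at the saddle point `r = K / log n` changes the
coefficient of `z ^ (K + 1)` in `p(z) A_n(z)` only to second order. -/
lemma abs_coeff_sub_eval_mul_cyclePoly_le {N K : ℕ} {r ε B : ℝ} (hN : 1 ≤ N)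
    (hr : r = K / Real.log (N + 1)) (hε : 0 < ε) {p : ℝ[X]}
    (hp : NormLE (r + ε + ε) (p : ℝ⟦X⟧) B) :
    |((p - C (p.eval r)) * cyclePoly (N + 1)).coeff (K + 1)| ≤
      Real.log (N + 1) ^ K / K.factorial / (N + 1) * (K / Real.log (N + 1) ^ 2) *
        (Real.exp (4 * ((r + ε + 1) * (1 + Real.log (r + ε + 1))) + (r + ε)) * B / ε ^ 2) := by
  have hL : 0 < Real.log (N + 1) := by
    apply Real.log_pos
    have : (1 : ℝ) ≤ N := by exact_mod_cast hN
    linarith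
  have hr0 : 0 ≤ r := by rw [hr]; positivity
  obtain ⟨Q, hQ, hQN⟩ := exists_sub_eval_eq_mul hr0 (by linarith : r ≤ r + ε) hε hp
  have h1 := abs_coeff_expSeries_mul_sub_le hL hr hε
    ((normLE_cycleCorrection (by linarith : 0 ≤ r + ε) N).mul (by linarith) hQN)
  have h2 : ((p - C (p.eval r)) * cyclePoly (N + 1)).coeff (K + 1) = ((N : ℝ) + 1)⁻¹ *
      PowerSeries.coeff K (expSeries (Real.log (N + 1)) * (PowerSeries.X - PowerSeries.C r) *
        (cycleCorrection N * (Q : ℝ⟦X⟧))) := by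
    have h3 : (((p - C (p.eval r)) * cyclePoly (N + 1) : ℝ[X]) : ℝ⟦X⟧) = PowerSeries.X *
        (PowerSeries.C ((N : ℝ) + 1)⁻¹ * (expSeries (Real.log (N + 1)) *
          (PowerSeries.X - PowerSeries.C r) * (cycleCorrection N * (Q : ℝ⟦X⟧)))) := by
      rw [hQ, Polynomial.coe_mul, coe_cyclePoly_succ, ← expSeries_log_mul_cycleCorrection]
      push_cast
      ring
    rw [← Polynomial.coeff_coe, h3, PowerSeries.coeff_succ_X_mul, PowerSeries.coeff_C_mul]
  rw [h2, abs_mul, abs_of_nonneg (by positivity)]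
  calc _ ≤ ((N : ℝ) + 1)⁻¹ * _ := mul_le_mul_of_nonneg_left h1 (by positivity)
    _ = _ := by
      rw [show r / Real.log (N + 1) = K / Real.log (N + 1) ^ 2 by rw [hr]; field_simp]
      field_simp

/-! ### Shifting the degree in the generating polynomial of the number of cycles -/

/-- The bound `O(n ^ r / (j + 1))` for all `j ≤ n`, valid for `j = 0` as well. -/
lemma normLE_cyclePoly {r : ℝ} (hr : 0 ≤ r) {j n : ℕ} (hj : j ≤ n) :
    NormLE r (cyclePoly j : ℝ⟦X⟧)
      ((2 * r + 1) * Real.exp (r * (1 + Real.log n)) / (j + 1)) := by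
  have hlog : 0 ≤ Real.log n := Real.log_natCast_nonneg n
  have hE : 1 ≤ Real.exp (r * (1 + Real.log n)) := Real.one_le_exp (by positivity)
  cases j with
  | zero =>
    rw [cyclePoly_zero, Polynomial.coe_one]
    refine (normLE_one hr).mono ?_
    simp only [Nat.cast_zero, zero_add, div_one]
    nlinarith
  | succ j =>
    rw [coe_cyclePoly_succ]
    have h1 : NormLE r (∏ i ∈ Finset.range j,
        (1 + PowerSeries.C ((i : ℝ) + 1)⁻¹ * PowerSeries.X))
        (∏ i ∈ Finset.range j, (1 + ((i : ℝ) + 1)⁻¹ * r)) :=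
      NormLE.prod hr fun i _ => (normLE_one hr).add hr (normLE_C_mul_X hr (by positivity))
    refine ((normLE_C_mul_X hr (by positivity)).mul hr h1).mono ?_
    have h2 : ∏ i ∈ Finset.range j, (1 + ((i : ℝ) + 1)⁻¹ * r) ≤
        Real.exp (r * (1 + Real.log n)) := by
      calc _ ≤ ∏ i ∈ Finset.range j, Real.exp (((i : ℝ) + 1)⁻¹ * r) :=
            Finset.prod_le_prod (fun i _ => by positivity) fun i _ => by
              linarith [Real.add_one_le_exp (((i : ℝ) + 1)⁻¹ * r)]
        _ = Real.exp (r * ∑ i ∈ Finset.range j, ((i : ℝ) + 1)⁻¹) := by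
            rw [← Real.exp_sum, ← Finset.sum_mul, mul_comm]
        _ ≤ _ := by
            gcongr
            calc _ ≤ ∑ i ∈ Finset.range n, ((i : ℝ) + 1)⁻¹ :=
                  Finset.sum_le_sum_of_subset_of_nonneg
                    (Finset.range_subset_range.2 (by omega)) fun _ _ _ => by positivity
              _ ≤ _ := sum_inv_le_one_add_log n
    have h3 : ((j : ℝ) + 1)⁻¹ * r ≤ (2 * r + 1) / (j + 1 + 1) := by
      rw [le_div_iff₀ (by positivity), inv_mul_eq_div, div_mul_eq_mul_div,
        div_le_iff₀ (by positivity)]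
      have : (0 : ℝ) ≤ j := by positivity
      nlinarith [mul_nonneg hr this]
    push_cast
    calc _ ≤ (2 * r + 1) / ((j : ℝ) + 1 + 1) * Real.exp (r * (1 + Real.log n)) := by gcongr
      _ = _ := by ring

/-- `cyclePoly (n - m)`, understood as `0` when `m > n`. -/
def cyclePolySub (n m : ℕ) : ℝ[X] := if m ≤ n then cyclePoly (n - m) else 0

/-- Shifting the index of `A_n(z)`, which behaves like `n ^ (z - 1)`, saves a factor of order `n`,
with polynomial dependence on the shift. -/
lemma normLE_cyclePolySub_sub {r : ℝ} (hr : 0 ≤ r) {n m : ℕ} (hn : 1 ≤ n) (hm : 1 ≤ m) :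
    NormLE r ((cyclePolySub n m - cyclePoly n : ℝ[X]) : ℝ⟦X⟧)
      ((r + 1) * (2 * r + 1) * Real.exp (r * (1 + Real.log n)) * m ^ 3 / n ^ 2) := by
  set D : ℝ := (2 * r + 1) * Real.exp (r * (1 + Real.log n)) with hD
  have hD0 : 0 ≤ D := by positivity
  have hn0 : (1 : ℝ) ≤ n := by exact_mod_cast hn
  have hm0 : (1 : ℝ) ≤ m := by exact_mod_cast hm
  have hstep : ∀ j, j < n → NormLE r ((cyclePoly j - cyclePoly (j + 1) : ℝ[X]) : ℝ⟦X⟧)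
      ((r + 1) * D / ((j : ℝ) + 1) ^ 2) := by
    intro j hj
    have h1 : ((cyclePoly j - cyclePoly (j + 1) : ℝ[X]) : ℝ⟦X⟧) =
        ((j : ℝ) + 1)⁻¹ • ((1 - PowerSeries.X) * (cyclePoly j : ℝ⟦X⟧)) := by
      rw [cyclePoly_succ, PowerSeries.smul_eq_C_mul]
      push_cast
      have h2 : (1 : ℝ⟦X⟧) = PowerSeries.C ((j : ℝ) + 1)⁻¹ * (PowerSeries.C (j : ℝ) + 1) := by
        rw [← map_one PowerSeries.C, ← map_add, ← map_mul, inv_mul_cancel₀ (by positivity)]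
      linear_combination (cyclePoly j : ℝ⟦X⟧) * h2
    have h3 : NormLE r (PowerSeries.X : ℝ⟦X⟧) r := by
      simpa using normLE_C_mul_X hr zero_le_one
    rw [h1]
    refine ((((normLE_one hr).sub hr h3).mul hr (normLE_cyclePoly hr hj.le)).smul _).mono
      (le_of_eq ?_)
    rw [abs_of_nonneg (by positivity)]
    field_simp
    ring
  rw [cyclePolySub]
  split_ifs with hmn
  · have h1 : cyclePoly (n - m) - cyclePoly n = ∑ l ∈ Finset.range m,
        (cyclePoly (n - m + l) - cyclePoly (n - m + l + 1)) := by
      have := Finset.sum_range_sub' (fun l => cyclePoly (n - m + l)) m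
      simp only [add_zero, Nat.sub_add_cancel hmn] at this
      rw [← this]
      rfl
    have h2 : ((cyclePoly (n - m) - cyclePoly n : ℝ[X]) : ℝ⟦X⟧) = ∑ l ∈ Finset.range m,
        ((cyclePoly (n - m + l) - cyclePoly (n - m + l + 1) : ℝ[X]) : ℝ⟦X⟧) := by
      rw [h1, ← Polynomial.coeToPowerSeries.ringHom_apply, map_sum]
      rfl
    rw [h2]
    refine (NormLE.sum (B := fun _ => (r + 1) * D * m ^ 2 / n ^ 2) hr fun l hl => ?_).mono
      (le_of_eq ?_)
    · rw [Finset.mem_range] at hl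
      refine (hstep _ (by omega)).mono ?_
      rw [div_eq_mul_one_div ((r + 1) * D), mul_div_assoc ((r + 1) * D)]
      refine mul_le_mul_of_nonneg_left ?_ (by positivity)
      rw [div_le_div_iff₀ (by positivity) (by positivity), one_mul, ← mul_pow]
      gcongr
      -- `n ≤ m (n - m + 1)` for `1 ≤ m ≤ n`, as `(m - 1) (n - m) ≥ 0`.
      obtain ⟨d, rfl⟩ := Nat.exists_eq_add_of_le hmn
      rw [Nat.add_sub_cancel_left]
      push_cast
      have h3 : (0 : ℝ) ≤ d := by positivity
      have h4 : (0 : ℝ) ≤ l := by positivity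
      nlinarith [mul_nonneg h3 (by linarith : (0 : ℝ) ≤ m - 1),
        mul_nonneg h4 (by linarith : (0 : ℝ) ≤ m)]
    · rw [Finset.sum_const, Finset.card_range, nsmul_eq_mul, hD]
      ring
  · rw [zero_sub]
    have h1 : ((-cyclePoly n : ℝ[X]) : ℝ⟦X⟧) = -(cyclePoly n : ℝ⟦X⟧) := by
      rw [← Polynomial.coeToPowerSeries.ringHom_apply, map_neg]
      rfl
    rw [h1]
    refine (normLE_cyclePoly hr le_rfl).neg.mono ?_
    rw [← hD, mul_assoc (r + 1), ← hD, div_le_div_iff₀ (by positivity) (by positivity)]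
    have h2 : (n : ℝ) ≤ m := by exact_mod_cast (by omega : n ≤ m)
    have h3 : (n : ℝ) ^ 2 ≤ (r + 1) * m ^ 3 * (n + 1) := by
      calc (n : ℝ) ^ 2 ≤ 1 * (m : ℝ) ^ 2 * 1 := by rw [one_mul, mul_one]; gcongr
        _ ≤ (r + 1) * m ^ 3 * (n + 1) := by
          gcongr
          · linarith
          · norm_num
          · linarith
    calc D * n ^ 2 ≤ D * ((r + 1) * m ^ 3 * (n + 1)) := by gcongr
      _ = _ := by ring

/-- A weak form of Stirling's upper bound. -/
lemma exp_mul_factorial_le (K : ℕ) :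
    Real.exp K * K.factorial ≤ Real.exp 1 * (K + 1) * (K : ℝ) ^ K := by
  have key : ∀ m : ℕ, Real.exp ((m + 1 : ℕ) : ℝ) * (m + 1).factorial ≤
      Real.exp 1 * ((m + 1 : ℕ) : ℝ) ^ (m + 2) := by
    intro m
    induction m with
    | zero => simp
    | succ m ih =>
      have h1 : Real.exp 1 * ((m + 1 : ℕ) : ℝ) ^ (m + 2) ≤ ((m + 2 : ℕ) : ℝ) ^ (m + 2) := by
        have h2 := Real.one_sub_le_exp_neg (1 / ((m + 2 : ℕ) : ℝ))
        have h3 : 1 - 1 / ((m + 2 : ℕ) : ℝ) = ((m + 1 : ℕ) : ℝ) / ((m + 2 : ℕ) : ℝ) := by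
          push_cast; field_simp; ring
        rw [h3] at h2
        have h4 := pow_le_pow_left₀ (by positivity) h2 (m + 2)
        rw [← Real.exp_nat_mul, div_pow, div_le_iff₀ (by positivity)] at h4
        have h5 : ((m + 2 : ℕ) : ℝ) * -(1 / ((m + 2 : ℕ) : ℝ)) = -1 := by
          field_simp
        rw [h5] at h4
        calc _ ≤ Real.exp 1 * (Real.exp (-1) * ((m + 2 : ℕ) : ℝ) ^ (m + 2)) := by gcongr
          _ = _ := by rw [← mul_assoc, ← Real.exp_add]; simp
      have h6 : Real.exp ((m + 1 + 1 : ℕ) : ℝ) = Real.exp ((m + 1 : ℕ) : ℝ) * Real.exp 1 := by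
        rw [← Real.exp_add]; push_cast; rfl
      rw [h6, Nat.factorial_succ, Nat.cast_mul]
      calc Real.exp ((m + 1 : ℕ) : ℝ) * Real.exp 1 *
            (((m + 1 + 1 : ℕ) : ℝ) * ((m + 1).factorial : ℝ))
          = Real.exp 1 * ((m + 2 : ℕ) : ℝ) *
            (Real.exp ((m + 1 : ℕ) : ℝ) * (m + 1).factorial) := by push_cast; ring
        _ ≤ Real.exp 1 * ((m + 2 : ℕ) : ℝ) * (Real.exp 1 * ((m + 1 : ℕ) : ℝ) ^ (m + 2)) := by
            gcongr
        _ ≤ Real.exp 1 * ((m + 2 : ℕ) : ℝ) * ((m + 2 : ℕ) : ℝ) ^ (m + 2) := by gcongr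
        _ = _ := by push_cast; ring
  cases K with
  | zero => simp
  | succ m =>
    refine (key m).trans ?_
    rw [pow_succ, mul_comm (((m + 1 : ℕ) : ℝ) ^ (m + 1)), ← mul_assoc]
    gcongr
    linarith

lemma log_sq_le {x : ℝ} (hx : 1 ≤ x) : Real.log x ^ 2 ≤ 4 * x := by
  have h1 : Real.log x = 2 * Real.log (√x) := by rw [Real.log_sqrt (by linarith)]; ring
  have h2 : Real.log (√x) ≤ √x := Real.log_le_self (Real.sqrt_nonneg x)
  have h3 : 0 ≤ Real.log x := Real.log_nonneg hx
  calc Real.log x ^ 2 ≤ (2 * √x) ^ 2 := by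
        apply pow_le_pow_left₀ h3
        linarith
    _ = 4 * x := by rw [mul_pow, Real.sq_sqrt (by linarith)]; ring

/-- The terms in which `A_{n - m}` is replaced by `A_n`, bounded by the norm at the
radius `r` of the saddle point. The loss against the Poisson weight is a factor of order `√K`, here
even `K + 1`, while the shift saves `1 / n`. -/
lemma abs_coeff_mul_cyclePolySub_sub_le {n m K : ℕ} {r R B : ℝ} (hn : 2 ≤ n) (hm : 1 ≤ m)
    (hr : r = K / Real.log n) (hR : 0 < R) (hrR : r ≤ R) {p : ℝ[X]} (hp0 : p.coeff 0 = 0)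
    (hp : NormLE R (p : ℝ⟦X⟧) B) :
    |(p * (cyclePolySub n m - cyclePoly n)).coeff (K + 1)| ≤
      Real.log n ^ K / K.factorial / n * ((K + 1) / Real.log n ^ 2) *
        (4 * Real.exp 1 * ((r + 1) * (2 * r + 1) * Real.exp r) * B / R * m ^ 3) := by
  have hn1 : (1 : ℝ) < n := by exact_mod_cast (by omega : 1 < n)
  have hL : 0 < Real.log n := Real.log_pos hn1
  have hr0 : 0 ≤ r := by rw [hr]; positivity
  obtain ⟨s, rfl⟩ := X_dvd_iff.2 hp0
  rw [Polynomial.coe_mul, Polynomial.coe_X] at hp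
  have hs := (hp.of_X_mul hR).of_le hr0 hrR
  have h1 := (hs.mul hr0 (normLE_cyclePolySub_sub hr0 (by omega : 1 ≤ n) hm)).coeff_le hr0 K
  rw [← Polynomial.coe_mul, Polynomial.coeff_coe] at h1
  rw [mul_assoc, coeff_X_mul]
  -- For `K = 0` the radius `r` is `0`, but then `r ^ K = 1`.
  have hrK : 0 < r ^ K := by
    rcases Nat.eq_zero_or_pos K with rfl | hK
    · simp
    · have : 0 < r := by
        rw [hr]
        have : (0 : ℝ) < K := by exact_mod_cast hK
        positivity
      positivity
  refine le_of_mul_le_mul_right (h1.trans ?_) hrK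
  have h2 : Real.exp (r * (1 + Real.log n)) = Real.exp r * Real.exp K := by
    rw [← Real.exp_add, hr]; congr 1; field_simp
  have h3 : Real.log n ^ K * r ^ K = (K : ℝ) ^ K := by
    rw [← mul_pow, hr]; congr 1; field_simp
  have h4 : Real.exp K ≤ Real.exp 1 * (K + 1) * ((K : ℝ) ^ K / K.factorial) := by
    rw [← mul_div_assoc, le_div_iff₀ (by positivity)]
    exact exp_mul_factorial_le K
  have h5 : 1 / (n : ℝ) ≤ 4 / Real.log n ^ 2 := by
    rw [div_le_div_iff₀ (by positivity) (by positivity)]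
    linarith [log_sq_le hn1.le]
  have hB : 0 ≤ B := hp.nonneg
  rw [h2]
  calc B / R * ((r + 1) * (2 * r + 1) * (Real.exp r * Real.exp K) * m ^ 3 / n ^ 2)
      = B / R * ((r + 1) * (2 * r + 1) * Real.exp r) * m ^ 3 / n * Real.exp K * (1 / n) := by
        field_simp
    _ ≤ B / R * ((r + 1) * (2 * r + 1) * Real.exp r) * m ^ 3 / n *
        (Real.exp 1 * (K + 1) * ((K : ℝ) ^ K / K.factorial)) * (4 / Real.log n ^ 2) := by
        gcongr
    _ = _ := by
        rw [← h3]
        field_simp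

/-! ### Sequences with a given logarithmic derivative -/

section
variable {A : Type*} [CommRing A]

/-- The sequence `s` gives the coefficients of `u a'(u) / a(u)`, for the generating function
`a(u) = ∑ a_n u ^ n`, in multiplied-out form. -/
def IsLogDeriv (s a : ℕ → A) : Prop :=
  ∀ n : ℕ, (n : A) * a n = ∑ ij ∈ antidiagonal n, s ij.1 * a ij.2

lemma isLogDeriv_iff {s a : ℕ → A} : IsLogDeriv s a ↔
    PowerSeries.X * PowerSeries.derivative A (PowerSeries.mk a) =
      PowerSeries.mk s * PowerSeries.mk a := by
  rw [PowerSeries.ext_iff]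
  refine forall_congr' fun n => ?_
  have h : PowerSeries.coeff n (PowerSeries.X * PowerSeries.derivative A (PowerSeries.mk a)) =
      (n : A) * a n := by
    cases n with
    | zero => simp
    | succ n =>
      rw [PowerSeries.coeff_succ_X_mul, PowerSeries.coeff_derivative, PowerSeries.coeff_mk]
      push_cast; ring
  rw [h, PowerSeries.coeff_mul]
  simp only [PowerSeries.coeff_mk]

lemma IsLogDeriv.mul {s t a b : ℕ → A} (ha : IsLogDeriv s a) (hb : IsLogDeriv t b) :
    IsLogDeriv (fun n => s n + t n) (fun n => ∑ ij ∈ antidiagonal n, a ij.1 * b ij.2) := by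
  rw [isLogDeriv_iff] at *
  have h1 : PowerSeries.mk (fun n => ∑ ij ∈ antidiagonal n, a ij.1 * b ij.2) =
      PowerSeries.mk a * PowerSeries.mk b := by
    ext n; simp [PowerSeries.coeff_mul]
  have h2 : PowerSeries.mk (fun n => s n + t n) = PowerSeries.mk s + PowerSeries.mk t := by
    ext n; simp
  rw [h1, h2, Derivation.leibniz, smul_eq_mul, smul_eq_mul]
  linear_combination PowerSeries.mk b * ha + PowerSeries.mk a * hb

lemma IsLogDeriv.unique [IsDomain A] [CharZero A] {s a b : ℕ → A} (hs : s 0 = 0)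
    (ha : IsLogDeriv s a) (hb : IsLogDeriv s b) (h0 : a 0 = b 0) : a = b := by
  funext n
  induction n using Nat.strong_induction_on with
  | _ n ih =>
    rcases Nat.eq_zero_or_pos n with rfl | hn
    · exact h0
    · have hn0 : (n : A) ≠ 0 := by exact_mod_cast hn.ne'
      refine mul_left_cancel₀ hn0 ?_
      rw [ha n, hb n]
      refine Finset.sum_congr rfl ?_
      rintro ⟨i, j⟩ hij
      rw [mem_antidiagonal] at hij
      simp only at hij ⊢
      rcases Nat.eq_zero_or_pos i with rfl | hi
      · rw [hs, zero_mul, zero_mul]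
      · rw [ih j (by omega)]

/-- The sequence with constant term `1` and logarithmic derivative `e`, that is, the coefficients of
`exp (∑ e_j u ^ j / j)`. -/
def expCoeff [Algebra ℝ A] (e : ℕ → A) : ℕ → A
  | 0 => 1
  | n + 1 => ((n : ℝ) + 1)⁻¹ • ∑ j : Fin (n + 1), e (n + 1 - j) * expCoeff e j

lemma expCoeff_zero [Algebra ℝ A] (e : ℕ → A) : expCoeff e 0 = 1 := by rw [expCoeff]

lemma expCoeff_succ [Algebra ℝ A] {e : ℕ → A} (he : e 0 = 0) (n : ℕ) :
    expCoeff e (n + 1) = ((n : ℝ) + 1)⁻¹ •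
      ∑ ij ∈ antidiagonal (n + 1), e ij.1 * expCoeff e ij.2 := by
  rw [expCoeff, Finset.sum_fin_eq_sum_range]
  congr 1
  have h := Finset.Nat.sum_antidiagonal_swap (n := n + 1)
    (f := fun ij : ℕ × ℕ => e ij.1 * expCoeff e ij.2)
  rw [← h, Finset.Nat.sum_antidiagonal_eq_sum_range_succ_mk, Finset.sum_range_succ _ (n + 1)]
  simp only [Prod.swap, Nat.sub_self, he, zero_mul, add_zero]
  refine Finset.sum_congr rfl fun i hi => ?_
  rw [dif_pos (Finset.mem_range.1 hi)]

lemma isLogDeriv_expCoeff [Algebra ℝ A] {e : ℕ → A} (he : e 0 = 0) :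
    IsLogDeriv e (expCoeff e) := by
  intro n
  cases n with
  | zero => simp [he]
  | succ n =>
    rw [expCoeff_succ he]
    have h : ((n + 1 : ℕ) : A) = algebraMap ℝ A ((n : ℝ) + 1) := by simp
    rw [h, Algebra.smul_def, ← mul_assoc, ← map_mul, mul_inv_cancel₀ (by positivity), map_one,
      one_mul]
end

lemma expCoeff_nonneg {e : ℕ → ℝ} (he : ∀ j, 0 ≤ e j) (n : ℕ) : 0 ≤ expCoeff e n := by
  induction n using Nat.strong_induction_on with
  | _ n ih =>
    cases n with
    | zero => rw [expCoeff_zero]; exact zero_le_one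
    | succ n =>
      rw [expCoeff, smul_eq_mul]
      exact mul_nonneg (by positivity)
        (Finset.sum_nonneg fun j _ => mul_nonneg (he _) (ih _ j.2))

/-- Norms of the coefficients of `exp` are majorized by the same recursion applied to the norms. -/
lemma normLE_expCoeff {R : ℝ} (hR : 0 ≤ R) {e : ℕ → ℝ[X]} {ε : ℕ → ℝ}
    (h : ∀ j, NormLE R (e j : ℝ⟦X⟧) (ε j)) (n : ℕ) :
    NormLE R ((expCoeff e n : ℝ[X]) : ℝ⟦X⟧) (expCoeff ε n) := by
  induction n using Nat.strong_induction_on with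
  | _ n ih =>
    cases n with
    | zero => rw [expCoeff_zero, expCoeff_zero, Polynomial.coe_one]; exact normLE_one hR
    | succ n =>
      rw [expCoeff, expCoeff, smul_eq_mul]
      have h1 : ((((n : ℝ) + 1)⁻¹ • ∑ j : Fin (n + 1), e (n + 1 - j) * expCoeff e j : ℝ[X]) :
          ℝ⟦X⟧) = ((n : ℝ) + 1)⁻¹ •
            ∑ j : Fin (n + 1), (e (n + 1 - j) : ℝ⟦X⟧) * ((expCoeff e j : ℝ[X]) : ℝ⟦X⟧) := by
        rw [Polynomial.smul_eq_C_mul, PowerSeries.smul_eq_C_mul, Polynomial.coe_mul,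
          Polynomial.coe_C]
        congr 1
        rw [← Polynomial.coeToPowerSeries.ringHom_apply, map_sum]
        simp
      rw [h1]
      have h2 := (NormLE.sum hR (s := Finset.univ) fun (j : Fin (n + 1)) _ =>
        (h (n + 1 - j)).mul hR (ih j j.2)).smul ((n : ℝ) + 1)⁻¹
      rwa [abs_of_nonneg (by positivity)] at h2

lemma eval_expCoeff (r : ℝ) (e : ℕ → ℝ[X]) (n : ℕ) :
    (expCoeff e n).eval r = expCoeff (fun j => (e j).eval r) n := by
  induction n using Nat.strong_induction_on with
  | _ n ih =>
    cases n with
    | zero => simp [expCoeff_zero]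
    | succ n =>
      rw [expCoeff, expCoeff, eval_smul, eval_finsetSum]
      congr 1
      refine Finset.sum_congr rfl fun j _ => ?_
      rw [eval_mul, ih j j.2]

/-- The generating polynomial with nonnegative coefficients `exp (∑ e_j t ^ j / j)`, truncated, is
at most its full value: it satisfies the differential inequality `t P'(t) ≤ (∑ e_j t ^ j) P(t)`. -/
lemma sum_expCoeff_mul_pow_le {e : ℕ → ℝ} (he0 : e 0 = 0) (he : ∀ j, 0 ≤ e j) {ρ : ℝ} (hρ : 0 ≤ ρ)
    (M : ℕ) : ∑ m ∈ Finset.range M, expCoeff e m * ρ ^ m ≤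
      Real.exp (∑ j ∈ Finset.range M, e j / j * ρ ^ j) := by
  set c := expCoeff e with hc
  have hc0 : ∀ m, 0 ≤ c m := expCoeff_nonneg he
  set P : ℝ → ℝ := fun t => ∑ m ∈ Finset.range M, c m * t ^ m with hP
  set Λ : ℝ → ℝ := fun t => ∑ j ∈ Finset.range M, e j / j * t ^ j with hΛ
  have hP' : ∀ t, HasDerivAt P (∑ m ∈ Finset.range M, c m * (m * t ^ (m - 1))) t := fun t =>
    HasDerivAt.fun_sum fun m _ => (hasDerivAt_pow m t).const_mul (c m)
  have hΛ' : ∀ t, HasDerivAt Λ (∑ j ∈ Finset.range M, e j / j * (j * t ^ (j - 1))) t := fun t =>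
    HasDerivAt.fun_sum fun j _ => (hasDerivAt_pow j t).const_mul (e j / j)
  have hf' : ∀ t, HasDerivAt (fun t => P t * Real.exp (-Λ t)) _ t := fun t =>
    (hP' t).mul (hΛ' t).neg.exp
  -- The coefficients of `t P'` up to `M` are those of the untruncated product, and all coefficients
  -- are nonnegative, so the product of the truncations can only be larger.
  have key : ∀ t, 0 < t → ∑ m ∈ Finset.range M, c m * (m * t ^ (m - 1)) ≤
      (∑ j ∈ Finset.range M, e j / j * (j * t ^ (j - 1))) * P t := by
    intro t ht
    refine le_of_mul_le_mul_left ?_ ht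
    have h1 : t * ∑ m ∈ Finset.range M, c m * (m * t ^ (m - 1)) =
        ∑ m ∈ Finset.range M, |PowerSeries.coeff m (PowerSeries.mk e * PowerSeries.mk c)| *
          t ^ m := by
      rw [Finset.mul_sum]
      refine Finset.sum_congr rfl fun m _ => ?_
      have h2 : PowerSeries.coeff m (PowerSeries.mk e * PowerSeries.mk c) = m * c m := by
        rw [PowerSeries.coeff_mul, isLogDeriv_expCoeff he0 m]
        simp [hc]
      rw [h2, abs_of_nonneg (mul_nonneg (by positivity) (hc0 m))]
      cases m with
      | zero => simp
      | succ m => rw [Nat.add_sub_cancel]; ring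
    have h3 : t * ((∑ j ∈ Finset.range M, e j / j * (j * t ^ (j - 1))) * P t) =
        (∑ j ∈ Finset.range M, e j * t ^ j) * P t := by
      rw [← mul_assoc]
      refine congrArg (· * P t) ?_
      rw [Finset.mul_sum]
      refine Finset.sum_congr rfl fun j _ => ?_
      cases j with
      | zero => simp [he0]
      | succ j => rw [Nat.add_sub_cancel]; push_cast; field_simp; ring
    rw [h1, h3]
    have trunc : ∀ d : ℕ → ℝ, (∀ j, 0 ≤ d j) → NormLE t
        (PowerSeries.trunc M (PowerSeries.mk d) : ℝ⟦X⟧) (∑ j ∈ Finset.range M, d j * t ^ j) := by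
      intro d hd M'
      have h4 : ∀ j, |PowerSeries.coeff j (PowerSeries.trunc M (PowerSeries.mk d) : ℝ⟦X⟧)| * t ^ j =
          if j ∈ Finset.range M then d j * t ^ j else 0 := by
        intro j
        rw [Polynomial.coeff_coe, PowerSeries.coeff_trunc, PowerSeries.coeff_mk]
        simp only [Finset.mem_range]
        split_ifs
        · rw [abs_of_nonneg (hd j)]
        · simp
      simp only [h4]
      rw [← Finset.sum_filter]
      refine Finset.sum_le_sum_of_subset_of_nonneg ?_ fun j _ _ =>
        mul_nonneg (hd j) (by positivity)
      intro j hj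
      exact (Finset.mem_filter.1 hj).2
    have h5 := (trunc e he).mul ht.le (trunc c hc0) M
    refine le_trans (le_of_eq (Finset.sum_congr rfl fun m hm => ?_)) h5
    rw [PowerSeries.coeff_mul_eq_coeff_trunc_mul_trunc _ _ (Finset.mem_range.1 hm)]
  have hanti : AntitoneOn (fun t => P t * Real.exp (-Λ t)) (Set.Ici 0) := by
    refine antitoneOn_of_deriv_nonpos (convex_Ici 0)
      (fun t _ => (hf' t).continuousAt.continuousWithinAt)
      (fun t _ => (hf' t).differentiableAt.differentiableWithinAt) fun t ht => ?_
    rw [interior_Ici] at ht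
    rw [(hf' t).deriv]
    have := mul_le_mul_of_nonneg_right (key t ht) (Real.exp_pos (-Λ t)).le
    rw [Pi.neg_apply]
    linarith
  have h0 : P 0 * Real.exp (-Λ 0) ≤ 1 := by
    have h1 : Λ 0 = 0 := by
      refine Finset.sum_eq_zero fun j _ => ?_
      cases j with
      | zero => simp
      | succ j => simp
    rw [h1, neg_zero, Real.exp_zero, mul_one]
    cases M with
    | zero => simp [hP]
    | succ M =>
      simp only [hP]
      rw [Finset.sum_range_succ']
      simp [hc, expCoeff_zero]
  have h2 := (hanti Set.self_mem_Ici (Set.mem_Ici.2 hρ) hρ).trans h0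
  simp only at h2
  rw [Real.exp_neg, ← div_eq_mul_inv, div_le_one (Real.exp_pos _)] at h2
  exact h2

/-- If `∑ e_j ρ ^ j ≤ E` then the coefficients `c_m` of `exp (∑ e_j u ^ j / j)` satisfy
`∑ m c_m ρ ^ m ≤ E e ^ E`. -/
lemma sum_natCast_mul_expCoeff_le {e : ℕ → ℝ} (he0 : e 0 = 0) (he : ∀ j, 0 ≤ e j) {ρ E : ℝ}
    (hρ : 0 ≤ ρ) (hE : ∀ M, ∑ j ∈ Finset.range M, e j * ρ ^ j ≤ E) (M : ℕ) :
    ∑ m ∈ Finset.range M, (m : ℝ) * expCoeff e m * ρ ^ m ≤ E * Real.exp E := by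
  have h1 : NormLE ρ (PowerSeries.mk e) E := fun M => by
    simpa [abs_of_nonneg (he _)] using hE M
  have h2 : NormLE ρ (PowerSeries.mk (expCoeff e)) (Real.exp E) := fun M => by
    simp only [PowerSeries.coeff_mk, abs_of_nonneg (expCoeff_nonneg he _)]
    refine (sum_expCoeff_mul_pow_le he0 he hρ M).trans (Real.exp_le_exp.2 ?_)
    refine le_trans (Finset.sum_le_sum fun j _ => ?_) (hE M)
    gcongr
    rcases Nat.eq_zero_or_pos j with rfl | hj
    · simp [he0]
    · exact div_le_self (he j) (by exact_mod_cast hj)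
  refine le_trans (le_of_eq (Finset.sum_congr rfl fun m _ => ?_)) (h1.mul hρ h2 M)
  congr 1
  rw [PowerSeries.coeff_mul, isLogDeriv_expCoeff he0 m]
  simp only [PowerSeries.coeff_mk]
  exact (abs_of_nonneg (Finset.sum_nonneg fun x _ =>
    mul_nonneg (he _) (expCoeff_nonneg he _))).symm

lemma hasDerivAt_tsum_mul_pow {c : ℕ → ℝ} {ρ : ℝ} (hρ : 0 < ρ)
    (hc : Summable fun m : ℕ => (m : ℝ) * |c m| * ρ ^ m) {t : ℝ} (ht : |t| < ρ) :
    HasDerivAt (fun t => ∑' m, c m * t ^ m) (∑' m : ℕ, ((m : ℝ) + 1) * c (m + 1) * t ^ m) t := by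
  have h := hasDerivAt_tsum_of_isPreconnected (g := fun m t => c m * t ^ m)
    (g' := fun m t => c m * (m * t ^ (m - 1))) (u := fun m : ℕ => (m : ℝ) * |c m| * ρ ^ m / ρ)
    (t := Set.Ioo (-ρ) ρ) (y₀ := 0) (y := t) (hc.div_const ρ) isOpen_Ioo isPreconnected_Ioo
    (fun m y _ => (hasDerivAt_pow m y).const_mul (c m)) ?_ (by simpa using hρ) ?_ (abs_lt.1 ht)
  · have h1 : ∑' m : ℕ, c m * (m * t ^ (m - 1)) = ∑' m : ℕ, ((m : ℝ) + 1) * c (m + 1) * t ^ m := by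
      have h2 := tsum_eq_zero_add' (f := fun m : ℕ => c m * (m * t ^ (m - 1))) ?_
      · rw [h2]
        simp only [Nat.cast_zero, zero_mul, mul_zero, zero_add, Nat.add_sub_cancel]
        refine tsum_congr fun m => ?_
        push_cast; ring
      · refine Summable.of_norm_bounded (g := fun m : ℕ => ((m + 1 : ℕ) : ℝ) * |c (m + 1)| *
          ρ ^ (m + 1) / ρ) (((summable_nat_add_iff 1).2 hc).div_const ρ) fun m => ?_
        rw [norm_mul, norm_mul, norm_pow, Real.norm_eq_abs, Real.norm_eq_abs, Real.norm_eq_abs,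
          Nat.abs_cast, Nat.add_sub_cancel, pow_succ, mul_div_assoc, mul_div_assoc, div_self hρ.ne',
          mul_one]
        calc _ = ((m + 1 : ℕ) : ℝ) * |c (m + 1)| * |t| ^ m := by ring
          _ ≤ _ := by gcongr
    rw [← h1]
    exact h
  · intro m y hy
    rw [norm_mul, norm_mul, norm_pow, Real.norm_eq_abs, Real.norm_eq_abs, Real.norm_eq_abs,
      Nat.abs_cast]
    cases m with
    | zero => simp
    | succ m =>
      have hy' : |y| < ρ := abs_lt.2 hy
      rw [Nat.add_sub_cancel, pow_succ, mul_div_assoc, mul_div_assoc, div_self hρ.ne', mul_one]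
      calc _ = ((m + 1 : ℕ) : ℝ) * |c (m + 1)| * |y| ^ m := by ring
        _ ≤ _ := by gcongr
  · refine summable_of_ne_finset_zero (s := {0}) fun m hm => ?_
    have : m ≠ 0 := by simpa using hm
    simp [this]

/-- The formal identity `∑ expCoeff y m u ^ m = exp (∑ y_j u ^ j / j)` evaluated at `u = 1`, inside
the disc of convergence. -/
lemma tsum_expCoeff_eq_exp {y : ℕ → ℝ} (hy0 : y 0 = 0) {ρ : ℝ} (hρ : 1 < ρ)
    (hy : Summable fun j : ℕ => |y j| * ρ ^ j)
    (hx : Summable fun m : ℕ => (m : ℝ) * |expCoeff y m| * ρ ^ m) :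
    ∑' m, expCoeff y m = Real.exp (∑' j : ℕ, y j / j) := by
  have hρ0 : 0 < ρ := by linarith
  set x := expCoeff y with hxdef
  have hz : Summable fun j : ℕ => (j : ℝ) * |y j / j| * ρ ^ j := by
    refine hy.of_nonneg_of_le (fun j => by positivity) fun j => ?_
    gcongr
    rcases Nat.eq_zero_or_pos j with rfl | hj
    · simp
    · have : (0 : ℝ) < j := by exact_mod_cast hj
      rw [abs_div, Nat.abs_cast, mul_div_cancel₀ _ this.ne']
  set φ : ℝ → ℝ := fun t => ∑' m, x m * t ^ m with hφ
  set ψ : ℝ → ℝ := fun t => ∑' j : ℕ, y j / j * t ^ j with hψ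
  have hsx : ∀ t : ℝ, |t| < ρ → Summable fun m => ‖x m * t ^ m‖ := by
    intro t ht
    refine (summable_nat_add_iff 1).1 ?_
    refine ((summable_nat_add_iff 1).2 hx).of_nonneg_of_le (fun j => by positivity) fun m => ?_
    rw [norm_mul, norm_pow, Real.norm_eq_abs, Real.norm_eq_abs]
    gcongr
    refine le_mul_of_one_le_left (abs_nonneg _) ?_
    push_cast
    linarith [(Nat.cast_nonneg m : (0 : ℝ) ≤ m)]
  have hsy : ∀ t : ℝ, |t| < ρ → Summable fun j => ‖y (j + 1) * t ^ j‖ := by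
    intro t ht
    refine (((summable_nat_add_iff 1).2 hy).div_const ρ).of_nonneg_of_le
      (fun j => by positivity) fun m => ?_
    rw [norm_mul, norm_pow, Real.norm_eq_abs, Real.norm_eq_abs, pow_succ, mul_div_assoc,
      mul_div_assoc, div_self hρ0.ne', mul_one]
    gcongr
  have hprod : ∀ t : ℝ, |t| < ρ → ∑' m : ℕ, ((m : ℝ) + 1) * x (m + 1) * t ^ m =
      (∑' j : ℕ, ((j : ℝ) + 1) * (y (j + 1) / (j + 1 : ℕ)) * t ^ j) * φ t := by
    intro t ht
    have h1 : ∀ j : ℕ, ((j : ℝ) + 1) * (y (j + 1) / (j + 1 : ℕ)) * t ^ j = y (j + 1) * t ^ j := by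
      intro j; push_cast; field_simp
    simp only [h1, hφ]
    rw [tsum_mul_tsum_eq_tsum_sum_antidiagonal_of_summable_norm (hsy t ht) (hsx t ht)]
    refine tsum_congr fun m => ?_
    have h2 := isLogDeriv_expCoeff hy0 (m + 1)
    rw [Finset.Nat.sum_antidiagonal_succ, hy0, zero_mul, zero_add] at h2
    push_cast at h2
    rw [h2, Finset.sum_mul]
    refine Finset.sum_congr rfl fun ij hij => ?_
    rw [← mem_antidiagonal.1 hij, pow_add]
    ring
  have hd : ∀ t : ℝ, |t| < ρ → HasDerivAt (fun t => φ t * Real.exp (-ψ t)) 0 t := by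
    intro t ht
    have h1 := hasDerivAt_tsum_mul_pow hρ0 hx ht
    have h2 := hasDerivAt_tsum_mul_pow hρ0 hz ht
    refine (h1.mul h2.neg.exp).congr_deriv ?_
    rw [hprod t ht, Pi.neg_apply]
    ring
  have habs : ∀ t ∈ Set.Icc (0 : ℝ) 1, |t| < ρ := fun t ht => by
    rw [abs_of_nonneg ht.1]; linarith [ht.2]
  have hconst := constant_of_has_deriv_right_zero (a := 0) (b := 1)
    (f := fun t => φ t * Real.exp (-ψ t))
    (fun t ht => (hd t (habs t ht)).continuousAt.continuousWithinAt)
    (fun t ht => (hd t (habs t (Set.Ico_subset_Icc_self ht))).hasDerivWithinAt) 1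
    (Set.right_mem_Icc.2 zero_le_one)
  have hφ0 : φ 0 = 1 := by
    simp only [hφ]
    rw [tsum_eq_single 0 (fun m hm => by simp [hm])]
    simp [hxdef, expCoeff_zero]
  have hψ0 : ψ 0 = 0 := by
    simp only [hψ]
    rw [tsum_eq_single 0 (fun m hm => by simp [hm])]
    simp
  simp only [hφ0, hψ0, neg_zero, Real.exp_zero, mul_one] at hconst
  rw [Real.exp_neg, ← div_eq_mul_inv, div_eq_one_iff_eq (Real.exp_pos _).ne'] at hconst
  simpa [hφ, hψ] using hconst

/-! ### Comparing prime factors with cycles -/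

lemma isLogDeriv_cyclePoly : IsLogDeriv (fun j => if j = 0 then 0 else (X : ℝ[X])) cyclePoly := by
  have h : ∀ n : ℕ, ∑ ij ∈ antidiagonal n, X * cyclePoly ij.2 =
      ((n + 1 : ℕ) : ℝ[X]) * cyclePoly (n + 1) := by
    have hs : ∀ n : ℕ, ((n + 1 : ℕ) : ℝ[X]) * cyclePoly (n + 1) =
        (X + (n : ℝ[X])) * cyclePoly n := by
      intro n
      have h1 : ((n + 1 : ℕ) : ℝ[X]) = C ((n : ℝ) + 1) := by simp
      rw [cyclePoly_succ, h1, ← mul_assoc, ← mul_assoc, ← C_mul, mul_inv_cancel₀ (by positivity)]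
      simp
    intro n
    induction n with
    | zero =>
      have := hs 0
      simp only [zero_add, Nat.cast_one, one_mul, Nat.cast_zero, add_zero] at this
      simp [this]
    | succ n ih =>
      rw [Finset.Nat.sum_antidiagonal_succ]
      simp only
      rw [ih, hs (n + 1)]
      ring
  intro n
  cases n with
  | zero => simp
  | succ n =>
    rw [Finset.Nat.sum_antidiagonal_succ, ← h n]
    simp

section
variable (F : Type*) [Field F] [Finite F]

lemma two_le_card_real : (2 : ℝ) ≤ (Nat.card F : ℝ) := by
  exact_mod_cast Finite.one_lt_card (α := F)

/-- The difference between the logarithmic derivatives of the generating functions of `Ω` and of the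
number of cycles. Primes (as opposed to proper prime powers) do not contribute. -/
def errPoly (j : ℕ) : ℝ[X] :=
  ∑ x ∈ primePairs F j, C ((x.1.natDegree : ℝ) / (Nat.card F : ℝ) ^ j) * (X ^ x.2 - X)

lemma primePairs_zero : primePairs F 0 = ∅ := by
  refine Finset.eq_empty_of_forall_notMem fun x hx => ?_
  obtain ⟨-, hirr, h1, h2⟩ := mem_primePairs.1 hx
  have := hirr.natDegree_pos
  exact absurd h2 (by positivity)

lemma errPoly_zero : errPoly F 0 = 0 := by simp [errPoly, primePairs_zero]

lemma C_inv_mul_primePowerSum (j : ℕ) :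
    C (((Nat.card F : ℝ) ^ j)⁻¹) * primePowerSum F j =
      (if j = 0 then 0 else X) + errPoly F j := by
  rcases Nat.eq_zero_or_pos j with rfl | hj
  · simp [errPoly_zero, primePowerSum_zero]
  · have hq : (Nat.card F : ℝ) ^ j ≠ 0 := by have := two_le_card_real F; positivity
    have h1 : errPoly F j = C (((Nat.card F : ℝ) ^ j)⁻¹) * primePowerSum F j -
        C (((Nat.card F : ℝ) ^ j)⁻¹ * ∑ x ∈ primePairs F j, (x.1.natDegree : ℝ)) * X := by
      rw [errPoly, primePowerSum, Finset.mul_sum, Finset.mul_sum, map_sum, Finset.sum_mul,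
        ← Finset.sum_sub_distrib]
      refine Finset.sum_congr rfl fun x _ => ?_
      rw [div_eq_inv_mul, C_mul]
      ring
    rw [h1, sum_natDegree_primePairs hj, inv_mul_cancel₀ hq, if_neg hj.ne', C_1]
    ring

lemma isLogDeriv_omega : IsLogDeriv (fun j => (if j = 0 then 0 else X) + errPoly F j)
    (fun n => C (((Nat.card F : ℝ) ^ n)⁻¹) * omegaSum F n) := by
  intro n
  simp only [← C_inv_mul_primePowerSum]
  rw [mul_left_comm, natCast_mul_omegaSum, Finset.mul_sum]
  refine Finset.sum_congr rfl fun ij hij => ?_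
  rw [← mem_antidiagonal.1 hij, pow_add, mul_inv, C_mul]
  ring

/-- The probability generating polynomial of `Ω` is the convolution of that of the number of cycles
with the coefficients of `exp (∑ e_j u ^ j / j)`, where `e_j` is `errPoly F j`. -/
lemma C_inv_mul_omegaSum (n : ℕ) : C (((Nat.card F : ℝ) ^ n)⁻¹) * omegaSum F n =
    ∑ ij ∈ antidiagonal n, cyclePoly ij.1 * expCoeff (errPoly F) ij.2 := by
  have h := (isLogDeriv_omega F).unique (by simp [errPoly_zero])
    (isLogDeriv_cyclePoly.mul (isLogDeriv_expCoeff (errPoly_zero F)))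
    (by simp [omegaSum_zero, cyclePoly_zero, expCoeff_zero])
  exact congrFun h n

/-- The norm of `z ^ i - z`, or an upper bound for it: the weight of a prime power `P ^ i`. -/
def powWeight (R : ℝ) (i : ℕ) : ℝ := if i = 1 then 0 else R ^ i + R

lemma powWeight_nonneg {R : ℝ} (hR : 0 ≤ R) (i : ℕ) : 0 ≤ powWeight R i := by
  rw [powWeight]; split_ifs <;> positivity

/-- A bound for the norm of `errPoly F j`. -/
def errBound (R : ℝ) (j : ℕ) : ℝ :=
  ∑ x ∈ primePairs F j, (x.1.natDegree : ℝ) / (Nat.card F : ℝ) ^ j * powWeight R x.2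

lemma errBound_nonneg {R : ℝ} (hR : 0 ≤ R) (j : ℕ) : 0 ≤ errBound F R j :=
  Finset.sum_nonneg fun _ _ => mul_nonneg (by positivity) (powWeight_nonneg hR _)

lemma errBound_zero (R : ℝ) : errBound F R 0 = 0 := by simp [errBound, primePairs_zero]

lemma normLE_X_pow_sub_X {R : ℝ} (hR : 0 ≤ R) (i : ℕ) :
    NormLE R (PowerSeries.X ^ i - PowerSeries.X) (powWeight R i) := by
  rw [powWeight]
  split_ifs with h
  · subst h
    intro M
    simp
  · have h1 : NormLE R (PowerSeries.X ^ i) (R ^ i) := by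
      simpa [PowerSeries.X_pow_eq] using normLE_monomial hR i 1
    have h2 : NormLE R (PowerSeries.X) R := by
      simpa [PowerSeries.X_eq] using normLE_monomial hR 1 1
    exact h1.sub hR h2

lemma normLE_errPoly {R : ℝ} (hR : 0 ≤ R) (j : ℕ) :
    NormLE R (errPoly F j : ℝ⟦X⟧) (errBound F R j) := by
  have h : (errPoly F j : ℝ⟦X⟧) = ∑ x ∈ primePairs F j,
      ((x.1.natDegree : ℝ) / (Nat.card F : ℝ) ^ j) • (PowerSeries.X ^ x.2 - PowerSeries.X) := by
    rw [errPoly, ← Polynomial.coeToPowerSeries.ringHom_apply, map_sum]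
    refine Finset.sum_congr rfl fun x _ => ?_
    rw [Polynomial.coeToPowerSeries.ringHom_apply, PowerSeries.smul_eq_C_mul]
    push_cast
    rfl
  rw [h]
  refine NormLE.sum hR fun x _ => ?_
  have h2 := (normLE_X_pow_sub_X hR x.2).smul ((x.1.natDegree : ℝ) / (Nat.card F : ℝ) ^ j)
  rwa [abs_of_nonneg (by positivity)] at h2

lemma sum_pow_ite_le {y : ℝ} (hy : 0 ≤ y) (hy1 : y < 1) (M : ℕ) :
    ∑ i ∈ Finset.Icc 1 M, (if i = 1 then 0 else y ^ i) ≤ y ^ 2 / (1 - y) := by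
  rw [le_div_iff₀ (by linarith)]
  have h : ∀ M : ℕ, (∑ i ∈ Finset.Icc 1 (M + 1), (if i = 1 then 0 else y ^ i)) * (1 - y) =
      y ^ 2 - y ^ (M + 2) := by
    intro M
    induction M with
    | zero => simp
    | succ M ih =>
      rw [Finset.sum_Icc_succ_top (by omega), add_mul, ih, if_neg (by omega)]
      ring
  cases M with
  | zero => simp; positivity
  | succ M =>
    rw [h]
    have : 0 ≤ y ^ (M + 2) := by positivity
    linarith

lemma sum_pow_Icc_le {y : ℝ} (hy : 0 ≤ y) (hy1 : y < 1) (M : ℕ) :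
    ∑ i ∈ Finset.Icc 1 M, y ^ i ≤ y / (1 - y) := by
  rw [le_div_iff₀ (by linarith)]
  have h : (∑ i ∈ Finset.Icc 1 M, y ^ i) * (1 - y) = y - y ^ (M + 1) := by
    induction M with
    | zero => simp
    | succ M ih =>
      rw [Finset.sum_Icc_succ_top (by omega), add_mul, ih]
      ring
  rw [h]
  have : 0 ≤ y ^ (M + 1) := by positivity
  linarith

open Classical in
lemma sum_natDegree_mul_pow_le {y : ℝ} (hy : 0 ≤ y) (hy1 : (Nat.card F : ℝ) * y < 1) (M : ℕ) :
    ∑ P ∈ ((Finset.Icc 1 M).biUnion (monicFinset F)).filter Irreducible,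
      (P.natDegree : ℝ) * y ^ P.natDegree ≤
        (Nat.card F : ℝ) * y / (1 - (Nat.card F : ℝ) * y) := by
  set S := ((Finset.Icc 1 M).biUnion (monicFinset F)).filter Irreducible with hS
  have hmem : ∀ P ∈ S, P.Monic ∧ Irreducible P ∧ P.natDegree ∈ Finset.Icc 1 M := by
    intro P hP
    simp only [hS, Finset.mem_filter, Finset.mem_biUnion, mem_monicFinset] at hP
    obtain ⟨⟨d, hd, hm, rfl⟩, hirr⟩ := hP
    exact ⟨hm, hirr, hd⟩
  rw [← Finset.sum_fiberwise_of_maps_to (fun P hP => (hmem P hP).2.2)]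
  refine le_trans (Finset.sum_le_sum fun d hd => ?_)
    (sum_pow_Icc_le (by positivity : 0 ≤ (Nat.card F : ℝ) * y) hy1 M)
  have h1 : ∑ P ∈ S with P.natDegree = d, (P.natDegree : ℝ) ≤ (Nat.card F : ℝ) ^ d := by
    rw [← sum_natDegree_primePairs (Finset.mem_Icc.1 hd).1]
    rw [← Finset.sum_image (s := S.filter fun P => P.natDegree = d) (g := fun P => (P, 1))
      (f := fun x : F[X] × ℕ => (x.1.natDegree : ℝ)) (fun a _ b _ h => (Prod.mk.inj h).1)]
    refine Finset.sum_le_sum_of_subset_of_nonneg ?_ fun x _ _ => by positivity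
    intro x hx
    obtain ⟨P, hP, rfl⟩ := Finset.mem_image.1 hx
    rw [Finset.mem_filter] at hP
    exact mem_primePairs.2 ⟨(hmem P hP.1).1, (hmem P hP.1).2.1, le_rfl, by simpa using hP.2⟩
  calc ∑ P ∈ S with P.natDegree = d, (P.natDegree : ℝ) * y ^ P.natDegree
      = (∑ P ∈ S with P.natDegree = d, (P.natDegree : ℝ)) * y ^ d := by
        rw [Finset.sum_mul]
        refine Finset.sum_congr rfl fun P hP => ?_
        rw [(Finset.mem_filter.1 hP).2]
    _ ≤ (Nat.card F : ℝ) ^ d * y ^ d := by gcongr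
    _ = _ := (mul_pow _ _ _).symm

/-- The sum over proper prime powers converges in the region `|z u| < q`, `|u| ^ 2 < q`, and it is
of order `1 / q`. -/
lemma sum_primePairsLE_le {R ρ δ : ℝ} (hR : 0 ≤ R) (hρ : 0 ≤ ρ) (hρ1 : ρ ≤ 5 / 4) (hδ : 0 < δ)
    (hRρ : R * ρ ≤ (Nat.card F : ℝ) * (1 - δ)) (M : ℕ) :
    ∑ x ∈ primePairsLE F M, (x.1.natDegree : ℝ) *
      (ρ / (Nat.card F : ℝ)) ^ (x.2 * x.1.natDegree) * powWeight R x.2 ≤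
      8 * (R ^ 2 / δ + 3 * R) / (Nat.card F : ℝ) := by
  classical
  have hq := two_le_card_real F
  set q : ℝ := (Nat.card F : ℝ) with hqdef
  have hq0 : 0 < q := by linarith
  have hv : 0 ≤ ρ / q := by positivity
  have hv1 : ρ / q ≤ 5 / 8 := by rw [div_le_iff₀ hq0]; linarith
  have hinner : ∀ P : F[X], 1 ≤ P.natDegree → ∑ i ∈ Finset.Icc 1 M,
      (P.natDegree : ℝ) * (ρ / q) ^ (i * P.natDegree) * powWeight R i ≤
      (R ^ 2 / δ + 3 * R) * (P.natDegree * ((ρ / q) ^ 2) ^ P.natDegree) := by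
    intro P hP
    set x : ℝ := (ρ / q) ^ P.natDegree with hx
    have hx0 : 0 ≤ x := by positivity
    have hxv : x ≤ ρ / q := by
      have := pow_le_pow_of_le_one hv (by linarith) hP
      rwa [pow_one] at this
    have hRx : R * x ≤ 1 - δ := by
      calc R * x ≤ R * (ρ / q) := by gcongr
        _ = R * ρ / q := by ring
        _ ≤ 1 - δ := by rw [div_le_iff₀ hq0]; linarith
    have h1 : ∀ i, (P.natDegree : ℝ) * (ρ / q) ^ (i * P.natDegree) * powWeight R i =
        P.natDegree * ((if i = 1 then 0 else (R * x) ^ i) + R * (if i = 1 then 0 else x ^ i)) := by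
      intro i
      rw [mul_comm i, pow_mul, ← hx, powWeight]
      split_ifs
      · simp
      · rw [mul_pow]; ring
    simp only [h1]
    rw [← Finset.mul_sum, Finset.sum_add_distrib, ← Finset.mul_sum]
    have h2 := sum_pow_ite_le (by positivity : 0 ≤ R * x) (by linarith) M
    have h3 := sum_pow_ite_le hx0 (by linarith) M
    have h4 : (R * x) ^ 2 / (1 - R * x) ≤ (R * x) ^ 2 / δ := by gcongr; linarith
    have h5 : x ^ 2 / (1 - x) ≤ 3 * x ^ 2 := by
      rw [div_le_iff₀ (by linarith)]
      nlinarith [sq_nonneg x]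
    calc _ ≤ (P.natDegree : ℝ) * ((R * x) ^ 2 / δ + R * (3 * x ^ 2)) := by
          gcongr
          · exact h2.trans h4
          · exact h3.trans h5
      _ = _ := by
          have h6 : ((ρ / q) ^ 2) ^ P.natDegree = x ^ 2 := by
            rw [hx, ← pow_mul, ← pow_mul, mul_comm]
          rw [h6]
          ring
  rw [primePairsLE, Finset.sum_product]
  refine (Finset.sum_le_sum fun P hP => hinner P ?_).trans ?_
  · simp only [Finset.mem_filter, Finset.mem_biUnion, mem_monicFinset, Finset.mem_Icc] at hP
    obtain ⟨⟨d, hd, -, rfl⟩, -⟩ := hP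
    exact hd.1
  · rw [← Finset.mul_sum]
    have h6 : q * (ρ / q) ^ 2 = ρ ^ 2 / q := by field_simp
    have hρ2 : ρ ^ 2 ≤ 25 / 16 := by nlinarith
    have h7 : ρ ^ 2 / q ≤ 25 / 32 := by rw [div_le_iff₀ hq0]; linarith
    have h8 := sum_natDegree_mul_pow_le F (sq_nonneg (ρ / q)) (by rw [← hqdef, h6]; linarith) M
    rw [← hqdef, h6] at h8
    have h9 : ρ ^ 2 / q / (1 - ρ ^ 2 / q) ≤ 8 / q := by
      rw [div_le_iff₀ (by linarith), div_le_iff₀ hq0]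
      have : 8 / q * (1 - ρ ^ 2 / q) * q = 8 * (1 - ρ ^ 2 / q) := by field_simp
      rw [this]
      linarith
    have hR2 : 0 ≤ R ^ 2 / δ + 3 * R := by positivity
    calc _ ≤ (R ^ 2 / δ + 3 * R) * (8 / q) := mul_le_mul_of_nonneg_left (h8.trans h9) hR2
      _ = _ := by ring

lemma sum_errBound_mul_pow_le {R ρ δ : ℝ} (hR : 0 ≤ R) (hρ : 0 ≤ ρ) (hρ1 : ρ ≤ 5 / 4) (hδ : 0 < δ)
    (hRρ : R * ρ ≤ (Nat.card F : ℝ) * (1 - δ)) (M : ℕ) :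
    ∑ j ∈ Finset.range M, errBound F R j * ρ ^ j ≤
      8 * (R ^ 2 / δ + 3 * R) / (Nat.card F : ℝ) := by
  classical
  refine le_trans ?_ (sum_primePairsLE_le F hR hρ hρ1 hδ hRρ M)
  have h1 : ∀ j ∈ Finset.range M, errBound F R j * ρ ^ j = ∑ x ∈ primePairs F j,
      (x.1.natDegree : ℝ) * (ρ / (Nat.card F : ℝ)) ^ (x.2 * x.1.natDegree) * powWeight R x.2 := by
    intro j _
    rw [errBound, Finset.sum_mul]
    refine Finset.sum_congr rfl fun x hx => ?_
    rw [(mem_primePairs.1 hx).2.2.2, div_pow]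
    ring
  rw [Finset.sum_congr rfl h1, ← Finset.sum_biUnion]
  · refine Finset.sum_le_sum_of_subset_of_nonneg ?_ fun x _ _ =>
      mul_nonneg (by positivity) (powWeight_nonneg hR _)
    intro x hx
    obtain ⟨j, hj, hxj⟩ := Finset.mem_biUnion.1 hx
    obtain ⟨hm, hirr, hi, h⟩ := mem_primePairs.1 hxj
    have hd := hirr.natDegree_pos
    rw [Finset.mem_range] at hj
    rw [mem_primePairsLE]
    refine ⟨hm, hirr, ?_, hi, ?_⟩ <;> nlinarith
  · intro a _ b _ hab
    refine Finset.disjoint_left.2 fun x hx hx' => hab ?_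
    rw [← (mem_primePairs.1 hx).2.2.2, ← (mem_primePairs.1 hx').2.2.2]
end

/-! ### The Euler product -/

section
variable (F : Type*) [Field F] [Finite F]

open Classical in
/-- The terms of the logarithm of the Euler product `h_q(r)`, indexed by all pairs `(P, i)` and
supported on those with `P` a monic prime and `i ≥ 1`. -/
def logTerm (r : ℝ) (x : F[X] × ℕ) : ℝ :=
  if x.1.Monic ∧ Irreducible x.1 ∧ 1 ≤ x.2 then (r ^ x.2 - r) / (x.2 * polyNorm x.1 ^ x.2) else 0

lemma abs_logTerm_le {r : ℝ} (hr : 0 ≤ r) {x : F[X] × ℕ}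
    (hx : x.1.Monic ∧ Irreducible x.1 ∧ 1 ≤ x.2) :
    |logTerm F r x| ≤ (x.1.natDegree : ℝ) *
      (1 / (Nat.card F : ℝ)) ^ (x.2 * x.1.natDegree) * powWeight r x.2 := by
  have hq := two_le_card_real F
  have hd : (1 : ℝ) ≤ x.1.natDegree := by exact_mod_cast hx.2.1.natDegree_pos
  have hi : (1 : ℝ) ≤ x.2 := by exact_mod_cast hx.2.2
  rw [logTerm, if_pos hx, powWeight, polyNorm, ← pow_mul, mul_comm x.1.natDegree, abs_div, abs_mul,
    Nat.abs_cast, abs_of_nonneg (by positivity : 0 ≤ (Nat.card F : ℝ) ^ (x.2 * x.1.natDegree)),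
    one_div, inv_pow]
  split_ifs with h
  · simp [h]
  · have h1 : |r ^ x.2 - r| ≤ r ^ x.2 + r := by
      rw [abs_le]
      have := pow_nonneg hr x.2
      constructor <;> linarith
    have h2 : 0 < (Nat.card F : ℝ) ^ (x.2 * x.1.natDegree) := by positivity
    calc |r ^ x.2 - r| / (x.2 * (Nat.card F : ℝ) ^ (x.2 * x.1.natDegree))
        ≤ (r ^ x.2 + r) / (1 * (Nat.card F : ℝ) ^ (x.2 * x.1.natDegree)) := by gcongr
      _ = 1 * ((Nat.card F : ℝ) ^ (x.2 * x.1.natDegree))⁻¹ * (r ^ x.2 + r) := by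
          rw [one_mul, one_mul, div_eq_inv_mul]
      _ ≤ _ := by gcongr

lemma summable_logTerm {r δ : ℝ} (hr : 0 ≤ r) (hδ : 0 < δ)
    (hrq : r ≤ (Nat.card F : ℝ) * (1 - δ)) : Summable (logTerm F r) := by
  classical
  refine Summable.of_norm (summable_of_sum_le (c := 8 * (r ^ 2 / δ + 3 * r) / (Nat.card F : ℝ))
    (fun x => norm_nonneg _) fun s => ?_)
  set M := s.sup fun x => max x.1.natDegree x.2 with hM
  refine le_trans ?_ (sum_primePairsLE_le F hr zero_le_one (by norm_num) hδ (by rwa [mul_one]) M)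
  rw [← Finset.sum_filter_add_sum_filter_not s
    (fun x => x.1.Monic ∧ Irreducible x.1 ∧ 1 ≤ x.2) (fun x => ‖logTerm F r x‖)]
  have h0 : ∑ x ∈ s with ¬(x.1.Monic ∧ Irreducible x.1 ∧ 1 ≤ x.2), ‖logTerm F r x‖ = 0 :=
    Finset.sum_eq_zero fun x hx => by
      rw [logTerm, if_neg (Finset.mem_filter.1 hx).2, norm_zero]
  rw [h0, add_zero]
  refine (Finset.sum_le_sum fun x hx => abs_logTerm_le F hr (Finset.mem_filter.1 hx).2).trans ?_
  refine Finset.sum_le_sum_of_subset_of_nonneg ?_ fun x _ _ =>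
    mul_nonneg (by positivity) (powWeight_nonneg hr _)
  intro x hx
  obtain ⟨hxs, hm, hirr, hi⟩ := Finset.mem_filter.1 hx
  have h1 : max x.1.natDegree x.2 ≤ M := Finset.le_sup (f := fun x => max x.1.natDegree x.2) hxs
  rw [mem_primePairsLE]
  exact ⟨hm, hirr, (le_max_left _ _).trans h1, hi, (le_max_right _ _).trans h1⟩

/-- Summing the logarithm of the Euler product over the prime powers of degree `j`. -/
lemma hasSum_errPoly_eval_div {r : ℝ} (h : Summable (logTerm F r)) :
    HasSum (fun j : ℕ => (errPoly F j).eval r / j) (∑' x, logTerm F r x) := by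
  classical
  have h1 := h.hasSum.tsum_fiberwise
    (fun x : F[X] × ℕ => if x.1.Monic ∧ Irreducible x.1 ∧ 1 ≤ x.2 then x.2 * x.1.natDegree else 0)
  refine h1.congr_fun fun j => ?_
  rw [tsum_subtype, tsum_eq_sum (s := primePairs F j)]
  · rw [errPoly, eval_finsetSum, Finset.sum_div]
    refine Finset.sum_congr rfl fun x hx => ?_
    obtain ⟨hm, hirr, hi, hj⟩ := mem_primePairs.1 hx
    have hq := two_le_card_real F
    have hd : (1 : ℝ) ≤ x.1.natDegree := by exact_mod_cast hirr.natDegree_pos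
    have hi' : (1 : ℝ) ≤ x.2 := by exact_mod_cast hi
    rw [Set.indicator_of_mem (by simp [hm, hirr, hi, hj]), logTerm, if_pos ⟨hm, hirr, hi⟩, polyNorm,
      ← pow_mul, mul_comm x.1.natDegree, hj]
    simp only [eval_mul, eval_C, eval_sub, eval_pow, eval_X]
    rw [← hj]
    push_cast
    field_simp
  · intro x hx
    by_cases hp : x.1.Monic ∧ Irreducible x.1 ∧ 1 ≤ x.2
    · refine Set.indicator_of_notMem (fun hmem => hx ?_) _
      simp only [Set.mem_preimage, if_pos hp, Set.mem_singleton_iff] at hmem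
      exact mem_primePairs.2 ⟨hp.1, hp.2.1, hp.2.2, hmem⟩
    · have : logTerm F r x = 0 := by rw [logTerm, if_neg hp]
      simp [Set.indicator, this]

variable {F} in
lemma card_le_polyNorm {P : F[X]} (hP : Irreducible P) : (Nat.card F : ℝ) ≤ polyNorm P := by
  have := two_le_card_real F
  exact le_self_pow₀ (by linarith) hP.natDegree_pos.ne'

variable {F} in
lemma hFactor_pos {r : ℝ} {P : F[X]} (hP : Irreducible P) (hr : r < (Nat.card F : ℝ)) :
    0 < hFactor r P := by
  have hq := two_le_card_real F
  have hN := card_le_polyNorm hP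
  have hN0 : 0 < polyNorm P := by linarith
  have h1 : 0 < 1 - r / polyNorm P := by rw [sub_pos, div_lt_one hN0]; linarith
  have h2 : 0 < 1 - 1 / polyNorm P := by rw [sub_pos, div_lt_one hN0]; linarith
  rw [hFactor]
  positivity

variable {F} in
lemma hasSum_log_hFactor {r : ℝ} (hr0 : 0 ≤ r) (hr : r < (Nat.card F : ℝ)) {P : F[X]}
    (hm : P.Monic) (hP : Irreducible P) :
    HasSum (fun i : ℕ => logTerm F r (P, i)) (Real.log (hFactor r P)) := by
  have hq := two_le_card_real F
  have hN := card_le_polyNorm hP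
  set N := polyNorm P with hNdef
  have hN0 : 0 < N := by linarith
  have h1 : 0 < 1 - r / N := by rw [sub_pos, div_lt_one hN0]; linarith
  have h2 : 0 < 1 - 1 / N := by rw [sub_pos, div_lt_one hN0]; linarith
  have h3 := Real.hasSum_pow_div_log_of_abs_lt_one (x := r / N)
    (by rw [abs_of_nonneg (by positivity)]; linarith)
  have h4 := Real.hasSum_pow_div_log_of_abs_lt_one (x := 1 / N)
    (by rw [abs_of_nonneg (by positivity)]; linarith)
  have h5 : Real.log (hFactor r P) = -Real.log (1 - r / N) - r * -Real.log (1 - 1 / N) := by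
    rw [hFactor, ← hNdef, Real.log_mul (by positivity) (by positivity), Real.log_inv,
      Real.log_rpow h2]
    ring
  have h6 : logTerm F r (P, 0) = 0 := by simp [logTerm]
  rw [← hasSum_nat_add_iff' 1, Finset.sum_range_one, h6, sub_zero, h5]
  refine (h3.sub (h4.mul_left r)).congr_fun ?_
  intro i
  rw [logTerm, if_pos ⟨hm, hP, by simp⟩, ← hNdef]
  push_cast
  rw [div_pow, div_pow, one_pow]
  field_simp

/-- The Euler product converges, and its value is that of `exp (∑ e_j(r) u ^ j / j)` at `u = 1`. -/
lemma hasProd_hFactor {r δ : ℝ} (hr : 0 ≤ r) (hδ : 0 < δ)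
    (hrq : r ≤ (Nat.card F : ℝ) * (1 - δ)) :
    HasProd (fun P : monicPrimes F => hFactor r (P : F[X]))
      (Real.exp (∑' j : ℕ, (errPoly F j).eval r / j)) := by
  classical
  have hq := two_le_card_real F
  have hlt : r < (Nat.card F : ℝ) := by nlinarith
  have hs := summable_logTerm F hr hδ hrq
  rw [(hasSum_errPoly_eval_div F hs).tsum_eq]
  refine Real.hasProd_of_hasSum_log (fun P => hFactor_pos P.2.2 hlt) ?_
  have h1 := hs.hasSum.prod_fiberwise
    (g := (monicPrimes F).indicator fun P => Real.log (hFactor r P)) fun P => ?_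
  · exact (hasSum_subtype_iff_indicator (f := fun P : F[X] => Real.log (hFactor r P))
      (s := monicPrimes F)).2 h1
  · by_cases hP : P ∈ monicPrimes F
    · rw [Set.indicator_of_mem hP]
      exact hasSum_log_hFactor hr hlt hP.1 hP.2
    · rw [Set.indicator_of_notMem hP]
      have h2 : ∀ i : ℕ, logTerm F r (P, i) = 0 := fun i => by
        rw [logTerm, if_neg fun h => hP ⟨h.1, h.2.1⟩]
      simp only [h2]
      exact hasSum_zero
end

/-! ### The error term -/

section
variable (F : Type*) [Field F] [Finite F]

lemma probOmega_eq_sum (n k : ℕ) : probOmega F n k =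
    ∑ m ∈ Finset.range (n + 1), (expCoeff (errPoly F) m * cyclePolySub n m).coeff k := by
  have h := congrArg (fun p => Polynomial.coeff p k) (C_inv_mul_omegaSum F n)
  simp only [coeff_C_mul] at h
  rw [← coeff_omegaSum, div_eq_inv_mul, h, ← finsetSum_coeff,
    ← Finset.Nat.sum_antidiagonal_swap, Finset.Nat.sum_antidiagonal_eq_sum_range_succ_mk]
  congr 1
  refine Finset.sum_congr rfl fun m hm => ?_
  rw [cyclePolySub, if_pos (Nat.lt_succ_iff.1 (Finset.mem_range.1 hm)), mul_comm]
  rfl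

/-- For `m ≥ 1` the coefficient `g_m(z)` is divisible by `z`, because every `e_j(z)` is. -/
lemma coeff_zero_expCoeff_errPoly {m : ℕ} (hm : 1 ≤ m) : (expCoeff (errPoly F) m).coeff 0 = 0 := by
  have h : (fun j => (errPoly F j).eval 0) = fun _ => (0 : ℝ) := by
    funext j
    rw [errPoly, eval_finsetSum]
    refine Finset.sum_eq_zero fun x hx => ?_
    have : x.2 ≠ 0 := Nat.one_le_iff_ne_zero.1 (mem_primePairs.1 hx).2.2.1
    simp [this]
  rw [coeff_zero_eq_eval_zero, eval_expCoeff, h]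
  obtain ⟨m, rfl⟩ : ∃ l, m = l + 1 := ⟨m - 1, by omega⟩
  rw [expCoeff_succ rfl]
  simp

lemma exists_sq_le_mul_pow {ρ : ℝ} (hρ : 1 < ρ) :
    ∃ c : ℝ, 0 < c ∧ ∀ m : ℕ, (m : ℝ) ^ 2 ≤ c * ρ ^ m := by
  obtain ⟨b, hb⟩ := (tendsto_pow_const_div_const_pow_of_one_lt 2 hρ).bddAbove_range
  refine ⟨max b 1, by positivity, fun m => ?_⟩
  have h : (m : ℝ) ^ 2 / ρ ^ m ≤ b := hb (Set.mem_range_self m)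
  rw [div_le_iff₀ (by positivity)] at h
  refine h.trans ?_
  gcongr
  exact le_max_left _ _

/-- The error is a sum over `m ≥ 1` of two kinds of terms, in which the coefficients `g_m(z)` of
`exp (∑ e_j u ^ j / j)` enter only through their norm on a disc slightly larger than `|z| ≤ r`. -/
lemma abs_probOmega_sub_le {n K : ℕ} {r δ c : ℝ} (hn : 2 ≤ n) (hδ0 : 0 < δ) (hδ1 : δ < 1)
    (hr : r = K / Real.log n) (hrq : r ≤ (Nat.card F : ℝ) * (1 - δ))
    (hc : ∀ m : ℕ, (m : ℝ) ^ 2 ≤ c * (1 + δ / 4) ^ m) :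
    |probOmega F n (K + 1) - probCycles n (K + 1) * hEuler F r| ≤
      Real.log n ^ K / K.factorial / n * ((K + 1) / Real.log n ^ 2) *
        (4 * Real.exp 1 * ((r + 1) * (2 * r + 1) * Real.exp r) / (r + δ) +
          Real.exp (4 * ((r + δ / 2 + 1) * (1 + Real.log (r + δ / 2 + 1))) + (r + δ / 2)) /
            (δ / 2) ^ 2) *
        (c * (8 * ((r + δ) ^ 2 / (δ / 4) + 3 * (r + δ)) / Nat.card F *
          Real.exp (8 * ((r + δ) ^ 2 / (δ / 4) + 3 * (r + δ)) / Nat.card F))) := by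
  have hq := two_le_card_real F
  have hn1 : (1 : ℝ) < n := by exact_mod_cast (by omega : 1 < n)
  have hL : 0 < Real.log n := Real.log_pos hn1
  have hr0 : 0 ≤ r := by rw [hr]; positivity
  -- The gap between `r` and `q (1 - δ)` is shared: `R` leaves room for two steps of length `δ / 2`
  -- above `r`, and `ρ > 1` gives exponential decay in `m`, still with `R ρ ≤ q (1 - δ / 4)`.
  set R : ℝ := r + δ with hR
  set ρ : ℝ := 1 + δ / 4 with hρ
  have hR0 : 0 < R := by positivity
  have hrR : r ≤ R := by linarith
  have hρ1 : 1 < ρ := by rw [hρ]; linarith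
  have hRρ : R * ρ ≤ (Nat.card F : ℝ) * (1 - δ / 4) := by
    have h1 : R ≤ (Nat.card F : ℝ) * (1 - δ / 2) := by nlinarith
    calc R * ρ ≤ (Nat.card F : ℝ) * (1 - δ / 2) * ρ := by gcongr
      _ = (Nat.card F : ℝ) * ((1 - δ / 2) * ρ) := by ring
      _ ≤ _ := by
        gcongr
        rw [hρ]
        nlinarith
  set E : ℝ := 8 * (R ^ 2 / (δ / 4) + 3 * R) / (Nat.card F : ℝ) with hE
  set g := expCoeff (errPoly F) with hg
  set γ := expCoeff (errBound F R) with hγ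
  have hbound : ∀ M, ∑ j ∈ Finset.range M, errBound F R j * ρ ^ j ≤ E := fun M =>
    sum_errBound_mul_pow_le F hR0.le (by linarith) (by linarith) (by linarith) hRρ M
  have hγ0 : ∀ m, 0 ≤ γ m := expCoeff_nonneg (errBound_nonneg F hR0.le)
  have hγsum := sum_natCast_mul_expCoeff_le (errBound_zero F R) (errBound_nonneg F hR0.le)
    (by linarith : 0 ≤ ρ) hbound
  rw [← hγ] at hγsum
  have hnorm : ∀ m, NormLE R ((g m : ℝ[X]) : ℝ⟦X⟧) (γ m) :=
    normLE_expCoeff hR0.le (normLE_errPoly F hR0.le)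
  -- The value of the Euler product is `∑ g_m(r)`.
  have hy : ∀ j, |(errPoly F j).eval r| ≤ errBound F R j := fun j =>
    ((normLE_errPoly F hR0.le j).of_le hr0 hrR).abs_eval_le hr0
  have hx : ∀ m, |(g m).eval r| ≤ γ m := fun m => ((hnorm m).of_le hr0 hrR).abs_eval_le hr0
  have hγs : Summable fun m : ℕ => (m : ℝ) * γ m * ρ ^ m :=
    summable_of_sum_range_le (fun m => mul_nonneg (mul_nonneg (by positivity) (hγ0 m))
      (by positivity)) hγsum
  have hys : Summable fun j => |(errPoly F j).eval r| * ρ ^ j :=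
    (summable_of_sum_range_le (fun j => mul_nonneg (errBound_nonneg F hR0.le j) (by positivity))
      hbound).of_nonneg_of_le (fun j => by positivity) fun j => by gcongr; exact hy j
  have hxs : Summable fun m : ℕ => (m : ℝ) * |(g m).eval r| * ρ ^ m :=
    hγs.of_nonneg_of_le (fun m => by positivity) fun m => by gcongr; exact hx m
  have hEuler_eq : hEuler F r = ∑' m, (g m).eval r := by
    rw [hEuler, (hasProd_hFactor F hr0 hδ0 hrq).tprod_eq]
    simp only [hg, eval_expCoeff] at hxs ⊢
    exact (tsum_expCoeff_eq_exp (by simp [errPoly_zero]) hρ1 hys hxs).symm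
  have hxsum : Summable fun m => (g m).eval r := by
    refine Summable.of_norm ((summable_nat_add_iff 1).1 ?_)
    refine ((summable_nat_add_iff 1).2 hxs).of_nonneg_of_le (fun m => norm_nonneg _) fun m => ?_
    rw [Real.norm_eq_abs, mul_comm _ |_|, mul_assoc]
    refine le_mul_of_one_le_right (abs_nonneg _) (one_le_mul_of_one_le_of_one_le ?_ ?_)
    · push_cast; linarith [(Nat.cast_nonneg m : (0 : ℝ) ≤ m)]
    · exact one_le_pow₀ hρ1.le
  -- The error as a series; the term `m = 0` vanishes because `g_0 = 1`.
  set t : ℕ → ℝ := fun m => (g m * (cyclePolySub n m - cyclePoly n)).coeff (K + 1) +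
    ((g m - C ((g m).eval r)) * cyclePoly n).coeff (K + 1) with ht
  have ht' : ∀ m, t m = (g m * cyclePolySub n m).coeff (K + 1) -
      (g m).eval r * (cyclePoly n).coeff (K + 1) := by
    intro m
    rw [← coeff_C_mul, ← coeff_sub, ht]
    simp only
    rw [← coeff_add]
    congr 1
    ring
  have hsup : ∀ m ∉ Finset.range (n + 1), (g m * cyclePolySub n m).coeff (K + 1) = 0 := by
    intro m hm
    rw [Finset.mem_range, not_lt] at hm
    rw [cyclePolySub, if_neg (by omega), mul_zero, coeff_zero]
  have hdiff : probOmega F n (K + 1) - probCycles n (K + 1) * hEuler F r = ∑' m, t m := by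
    have h1 : ∑' m, (g m * cyclePolySub n m).coeff (K + 1) =
        ∑ m ∈ Finset.range (n + 1), (g m * cyclePolySub n m).coeff (K + 1) := tsum_eq_sum hsup
    have h2 : Summable fun m => (g m * cyclePolySub n m).coeff (K + 1) :=
      summable_of_ne_finset_zero hsup
    rw [probOmega_eq_sum, hEuler_eq, ← coeff_cyclePoly, mul_comm ((cyclePoly n).coeff (K + 1)),
      ← tsum_mul_right, ← h1, ← h2.tsum_sub (hxsum.mul_right _)]
    exact tsum_congr fun m => (ht' m).symm
  set T : ℝ := Real.log n ^ K / K.factorial / n * ((K + 1) / Real.log n ^ 2) with hT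
  have hT0 : 0 ≤ T := by positivity
  set Q₁ : ℝ := 4 * Real.exp 1 * ((r + 1) * (2 * r + 1) * Real.exp r) / R with hQ₁
  set Q₂ : ℝ := Real.exp (4 * ((r + δ / 2 + 1) * (1 + Real.log (r + δ / 2 + 1))) + (r + δ / 2)) /
    (δ / 2) ^ 2 with hQ₂
  have hQ₁0 : 0 ≤ Q₁ := by positivity
  have hQ₂0 : 0 ≤ Q₂ := by positivity
  have htle : ∀ m, ‖t m‖ ≤ T * (Q₁ + Q₂) * c * ((m : ℝ) * γ m * ρ ^ m) := by
    intro m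
    rcases Nat.eq_zero_or_pos m with rfl | hm
    · have : t 0 = 0 := by simp [ht', hg, expCoeff_zero, cyclePolySub]
      simp [this]
    · have h1 := abs_coeff_mul_cyclePolySub_sub_le hn hm hr hR0 hrR
        (coeff_zero_expCoeff_errPoly F hm) (hnorm m)
      obtain ⟨N, rfl⟩ : ∃ N, n = N + 1 := ⟨n - 1, by omega⟩
      have h2 := abs_coeff_sub_eval_mul_cyclePoly_le (N := N) (K := K) (r := r) (ε := δ / 2)
        (B := γ m) (p := g m) (by omega) (by rw [hr]; push_cast; rfl) (by linarith)
        (by rw [show r + δ / 2 + δ / 2 = R by rw [hR]; ring]; exact hnorm m)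
      have hm1 : (1 : ℝ) ≤ (m : ℝ) ^ 3 := one_le_pow₀ (by exact_mod_cast hm)
      have h3 : |(((g m) - C ((g m).eval r)) * cyclePoly (N + 1)).coeff (K + 1)| ≤
          T * (Q₂ * γ m * m ^ 3) := by
        refine h2.trans ?_
        have h4 : Real.exp (4 * ((r + δ / 2 + 1) * (1 + Real.log (r + δ / 2 + 1))) + (r + δ / 2)) *
            γ m / (δ / 2) ^ 2 = Q₂ * γ m := by rw [hQ₂]; ring
        rw [h4]
        have h5 : 0 ≤ Q₂ * γ m := mul_nonneg hQ₂0 (hγ0 m)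
        have h6 : Real.log (N + 1 : ℝ) ^ K / K.factorial / (N + 1) *
            (K / Real.log (N + 1 : ℝ) ^ 2) ≤ T := by
          rw [hT]
          push_cast
          push_cast at hL
          gcongr
          linarith
        exact mul_le_mul h6 (le_mul_of_one_le_right h5 hm1) h5 hT0
      have h7 : (m : ℝ) ^ 3 ≤ c * (m * ρ ^ m) := by
        calc (m : ℝ) ^ 3 = m * (m : ℝ) ^ 2 := by ring
          _ ≤ m * (c * ρ ^ m) := by gcongr; exact hc m
          _ = _ := by ring
      calc ‖t m‖ ≤ T * (4 * Real.exp 1 * ((r + 1) * (2 * r + 1) * Real.exp r) * γ m / R * m ^ 3) +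
            T * (Q₂ * γ m * m ^ 3) := (abs_add_le _ _).trans (add_le_add h1 h3)
        _ = T * (Q₁ + Q₂) * γ m * m ^ 3 := by rw [hQ₁]; ring
        _ ≤ T * (Q₁ + Q₂) * γ m * (c * (m * ρ ^ m)) := by
            have := hγ0 m
            gcongr
        _ = _ := by ring
  have hc0 : 0 ≤ c := by
    have := hc 0
    simpa using this
  rw [hdiff, ← Real.norm_eq_abs]
  refine (tsum_of_norm_bounded (hγs.hasSum.mul_left _) htle).trans ?_
  have h8 : ∑' m : ℕ, (m : ℝ) * γ m * ρ ^ m ≤ E * Real.exp E :=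
    hγs.tsum_le_of_sum_range_le hγsum
  calc _ ≤ T * (Q₁ + Q₂) * c * (E * Real.exp E) := by gcongr
    _ = _ := by ring
end

lemma le_two_add_mul_log {r : ℝ} (hr : 0 ≤ r) : r ≤ 2 + r * Real.log (r + 1) := by
  have hlog : 0 ≤ Real.log (r + 1) := Real.log_nonneg (by linarith)
  rcases le_total r 2 with h | h
  · nlinarith [mul_nonneg hr hlog]
  · have h1 : 1 ≤ Real.log (r + 1) := by
      rw [Real.le_log_iff_exp_le (by linarith)]
      linarith [Real.exp_one_lt_d9]
    nlinarith

/-- All the factors depending on `r` are absorbed by `C (r + 1) ^ (C r)`. -/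
lemma exists_const_bound {δ c : ℝ} (hδ0 : 0 < δ) (hδ1 : δ < 1) (hc : 0 < c) :
    ∃ D : ℝ, 0 < D ∧ ∀ r q : ℝ, 0 ≤ r → 2 ≤ q → r ≤ q * (1 - δ) →
      (4 * Real.exp 1 * ((r + 1) * (2 * r + 1) * Real.exp r) / (r + δ) +
          Real.exp (4 * ((r + δ / 2 + 1) * (1 + Real.log (r + δ / 2 + 1))) + (r + δ / 2)) /
            (δ / 2) ^ 2) *
        (c * (8 * ((r + δ) ^ 2 / (δ / 4) + 3 * (r + δ)) / q *
          Real.exp (8 * ((r + δ) ^ 2 / (δ / 4) + 3 * (r + δ)) / q))) ≤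
      D * (r + 1) ^ (D * r) / q := by
  set a : ℝ := 8 * (4 / δ + 3) with ha
  set b : ℝ := 8 * Real.exp 1 / δ + 4 / δ ^ 2 with hb
  have ha0 : 0 < a := by positivity
  have hb0 : 0 < b := by positivity
  refine ⟨b * c * (3 * a) * Real.exp (54 + 4 * a) + (22 + a), by positivity, ?_⟩
  intro r q hr hq hrq
  have hq0 : 0 < q := by linarith
  have hlog : 0 ≤ Real.log (r + 1) := Real.log_nonneg (by linarith)
  set Φ : ℝ := r * Real.log (r + 1) with hΦ
  have hΦ0 : 0 ≤ Φ := mul_nonneg hr hlog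
  have hrΦ : r ≤ 2 + Φ := le_two_add_mul_log hr
  have hexp : r + 1 ≤ Real.exp r := Real.add_one_le_exp r
  have h1 : 4 * Real.exp 1 * ((r + 1) * (2 * r + 1) * Real.exp r) / (r + δ) ≤
      8 * Real.exp 1 / δ * Real.exp (17 * r + 17 + 4 * Φ) := by
    have h2 : (r + 1) * (2 * r + 1) * Real.exp r ≤ 2 * Real.exp (17 * r + 17 + 4 * Φ) := by
      calc (r + 1) * (2 * r + 1) * Real.exp r ≤ Real.exp r * (2 * Real.exp r) * Real.exp r := by
            gcongr
            linarith
        _ = 2 * Real.exp (r + r + r) := by rw [Real.exp_add, Real.exp_add]; ring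
        _ ≤ _ := mul_le_mul_of_nonneg_left (Real.exp_le_exp.2 (by linarith)) zero_le_two
    calc _ ≤ 4 * Real.exp 1 * (2 * Real.exp (17 * r + 17 + 4 * Φ)) / δ := by
          gcongr; linarith
      _ = _ := by ring
  have h3 : Real.exp (4 * ((r + δ / 2 + 1) * (1 + Real.log (r + δ / 2 + 1))) + (r + δ / 2)) /
      (δ / 2) ^ 2 ≤ 4 / δ ^ 2 * Real.exp (17 * r + 17 + 4 * Φ) := by
    have h4 : Real.log (r + δ / 2 + 1) ≤ 1 + Real.log (r + 1) := by
      calc Real.log (r + δ / 2 + 1) ≤ Real.log (2 * (r + 1)) :=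
            Real.log_le_log (by positivity) (by linarith)
        _ = Real.log 2 + Real.log (r + 1) := Real.log_mul (by norm_num) (by positivity)
        _ ≤ _ := by linarith [Real.log_two_lt_d9]
    have h5 : Real.log (r + 1) ≤ r := by
      have := Real.log_le_sub_one_of_pos (by linarith : 0 < r + 1)
      linarith
    have h6 : (r + δ / 2 + 1) * (1 + Real.log (r + δ / 2 + 1)) ≤
        (r + 2) * (2 + Real.log (r + 1)) := by
      have : 0 ≤ Real.log (r + δ / 2 + 1) := Real.log_nonneg (by linarith)
      apply mul_le_mul <;> linarith
    have h7 : (r + 2) * (2 + Real.log (r + 1)) ≤ 4 * r + 4 + Φ := by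
      rw [hΦ]; nlinarith
    calc _ ≤ Real.exp (17 * r + 17 + 4 * Φ) / (δ / 2) ^ 2 :=
          div_le_div_of_nonneg_right (Real.exp_le_exp.2 (by linarith)) (by positivity)
      _ = _ := by field_simp; ring
  -- The bound `E` for the sum over prime powers is used twice: as `O_r(1 / q)` in the linear factor,
  -- and as `O(r + 1)`, by `r + δ ≤ q`, in the exponent.
  have hR1 : r + δ ≤ r + 1 := by linarith
  have h8 : 8 * ((r + δ) ^ 2 / (δ / 4) + 3 * (r + δ)) ≤ a * ((r + 1) ^ 2 + (r + 1)) := by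
    have e1 : (r + δ) ^ 2 / (δ / 4) = 4 / δ * (r + δ) ^ 2 := by field_simp
    have h9 : (r + δ) ^ 2 ≤ (r + 1) ^ 2 := by gcongr
    have h10 : 4 / δ * (r + δ) ^ 2 ≤ 4 / δ * (r + 1) ^ 2 := by gcongr
    have h11 : 0 ≤ 4 / δ * (r + 1) := by positivity
    rw [e1, ha]
    nlinarith [sq_nonneg (r + 1)]
  have h12 : a * ((r + 1) ^ 2 + (r + 1)) ≤ 3 * a * Real.exp (r + 1) := by
    have h13 := Real.quadratic_le_exp_of_nonneg (by linarith : 0 ≤ r + 1)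
    nlinarith
  have h14 : 8 * ((r + δ) ^ 2 / (δ / 4) + 3 * (r + δ)) / q ≤ a * (r + 2) := by
    have e1 : (r + δ) ^ 2 / (δ / 4) = 4 / δ * (r + δ) ^ 2 := by field_simp
    have h15 : r + δ ≤ q := by nlinarith
    rw [div_le_iff₀ hq0, e1, ha]
    have h16 : (r + δ) ^ 2 ≤ (r + 1) * q := by nlinarith
    have h17 : 4 / δ * (r + δ) ^ 2 ≤ 4 / δ * ((r + 1) * q) := by gcongr
    have h18 : 0 ≤ 4 / δ * q := by positivity
    nlinarith
  have hrpow : (r + 1) ^ ((b * c * (3 * a) * Real.exp (54 + 4 * a) + (22 + a)) * r) =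
      Real.exp ((b * c * (3 * a) * Real.exp (54 + 4 * a) + (22 + a)) * Φ) := by
    rw [Real.rpow_def_of_pos (by linarith), hΦ]
    ring_nf
  rw [hrpow]
  have hpos : 0 ≤ b * c * (3 * a) * Real.exp (54 + 4 * a) := by positivity
  calc _ ≤ (b * Real.exp (17 * r + 17 + 4 * Φ)) *
        (c * (3 * a * Real.exp (r + 1) / q * Real.exp (a * (r + 2)))) := by
        have h19 := add_le_add h1 h3
        rw [← add_mul] at h19
        have h20 := div_le_div_of_nonneg_right (h8.trans h12) hq0.le
        have h21 := Real.exp_le_exp.2 h14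
        gcongr
    _ = b * c * (3 * a) * Real.exp (17 * r + 17 + 4 * Φ + (r + 1) + a * (r + 2)) / q := by
        rw [Real.exp_add (17 * r + 17 + 4 * Φ + (r + 1)), Real.exp_add (17 * r + 17 + 4 * Φ)]
        ring
    _ ≤ b * c * (3 * a) * Real.exp (54 + 4 * a + (22 + a) * Φ) / q := by
        have h22 : a * r ≤ a * (2 + Φ) := by gcongr
        have h23 := Real.exp_le_exp.2 (by linarith :
          17 * r + 17 + 4 * Φ + (r + 1) + a * (r + 2) ≤ 54 + 4 * a + (22 + a) * Φ)
        gcongr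
    _ = b * c * (3 * a) * Real.exp (54 + 4 * a) * Real.exp ((22 + a) * Φ) / q := by
        rw [Real.exp_add (54 + 4 * a)]; ring
    _ ≤ _ := by
        have h24 := Real.exp_le_exp.2 (mul_le_mul_of_nonneg_right (by linarith :
          22 + a ≤ b * c * (3 * a) * Real.exp (54 + 4 * a) + (22 + a)) hΦ0)
        gcongr
        linarith

lemma probPoissonLog_eq {n : ℕ} (hn : 1 ≤ n) (j : ℕ) :
    probPoissonLog n j = Real.log n ^ j / j.factorial / n := by
  have hn0 : (0 : ℝ) < n := by exact_mod_cast hn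
  rw [probPoissonLog, ProbabilityTheory.poissonMeasure_real_singleton,
    Real.coe_toNNReal _ (Real.log_natCast_nonneg n), Real.exp_neg, Real.exp_log hn0]
  ring

end

theorem theorem1p3 (δ : ℝ) (hδ0 : 0 < δ) (hδ1 : δ < 1) :
    ∃ C : ℝ, 0 < C ∧
      ∀ (F : Type*) [Field F] [Finite F] (n k : ℕ) (r : ℝ),
        2 ≤ n → 1 ≤ k → k ≤ n →
        4 * (1 - δ) / δ ^ 2 ≤ (n : ℝ) →
        1 / (1 - δ) ^ 2 ≤ (Nat.card F : ℝ) →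
        r = ((k : ℝ) - 1) / Real.log n →
        r ≤ (Nat.card F : ℝ) * (1 - δ) →
          Multipliable (fun P : monicPrimes F => hFactor r (P : F[X])) ∧
          |probOmega F n k - probCycles n k * hEuler F r| ≤
            C * (r + 1) ^ (C * r) * probPoissonLog n (k - 1) *
              ((k : ℝ) / ((Nat.card F : ℝ) * Real.log n ^ 2)) := by
  obtain ⟨c, hc0, hc⟩ := exists_sq_le_mul_pow (by linarith : 1 < 1 + δ / 4)
  obtain ⟨D, hD0, hD⟩ := exists_const_bound hδ0 hδ1 hc0
  refine ⟨D, hD0, ?_⟩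
  intro F _ _ n k r hn hk _ _ _ hr hrq
  obtain ⟨K, rfl⟩ : ∃ K, k = K + 1 := ⟨k - 1, by omega⟩
  have hr' : r = K / Real.log n := by rw [hr]; push_cast; ring
  have hr0 : 0 ≤ r := by
    rw [hr']; exact div_nonneg (Nat.cast_nonneg K) (Real.log_natCast_nonneg n)
  have hq := two_le_card_real F
  refine ⟨(hasProd_hFactor F hr0 hδ0 hrq).multipliable, ?_⟩
  refine (abs_probOmega_sub_le F hn hδ0 hδ1 hr' hrq hc).trans ?_
  rw [mul_assoc, Nat.add_sub_cancel, probPoissonLog_eq (by omega)]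
  have hlog := Real.log_natCast_nonneg n
  calc _ ≤ Real.log n ^ K / K.factorial / n * ((K + 1) / Real.log n ^ 2) *
        (D * (r + 1) ^ (D * r) / Nat.card F) :=
        mul_le_mul_of_nonneg_left (hD r _ hr0 hq hrq) (by positivity)
    _ = _ := by
        push_cast
        ring
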